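/- Let $\mu_4=\langle\zeta_4\rangle\subset\mathbf C^\times$ with $\zeta_4=e^{2\pi i/4}$, and regard $A_6$ as the subgroup of inner automorphisms of $\mathrm{Aut}(A_6)$. Let $M_{10}$ be the Mathieu group of degree $10$, i.e. the pointwise stabilizer of two points in the Mathieu group $M_{12}$ (the automorphism group of the Steiner system $S(5,6,12)$) acting on twelve points. For each of the groups $A_6$, $S_6$, $\mathrm{PGL}(2,9)$, $M_{10}$ the group $\mathrm{Aut}(A_6)$ has exactly one subgroup isomorphic to it, denoted by the same symbol; $S_6$ acts on $A_6$ by conjugation. For an exact sequence $1\to A_6\to G\xrightarrow{\alpha}\mu_4\to 1$ let $c:G\to\mathrm{Aut}(A_6)$, $c(g)(a)=gag^{-1}$, and $N=c(G)$. Then $N$ is one of $A_6$, $S_6$, $\mathrm{PGL}(2,9)$, $M_{10}$, and $G$ is isomorphic to the subgroup $(A_6\times 1)\cdot\langle\tilde g\rangle$ of $N\times\mu_4$, where 1. if $N=A_6$: $\tilde g=(1,\zeta_4)$, and the subgroup is $A_6\times\mu_4$; 2. if $N=S_6$: $\tilde g=(g,\zeta_4)$ with $g=(1\,2)\in S_6$;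 3. if $N=\mathrm{PGL}(2,9)$: $\tilde g=(h^5,\zeta_4)$, with $h$ any element of order $10$ of $\mathrm{PGL}(2,9)$; 4. if $N=M_{10}$: $\tilde g=(g,\zeta_4)$, with $g$ any element of order $4$ of $M_{10}\setminus A_6$. Such elements $h$ and $g$ exist. In each case $\tilde g$ has order $4$ and the subgroup is the semidirect product $A_6:\langle\tilde g\rangle$, with $\tilde g$ acting on $A_6$ through its first component. With the inclusion of $A_6\times 1$ and the second projection it is an extension of $\mu_4$ by $A_6$ whose image in $\mathrm{Aut}(A_6)$ is the given $N$. The groups in 1.–4., denoted $A_6(4)$, $S_6(2)$, $\mathrm{PGL}(2,9)(2)$, $M_{10}(2)$, are pairwise non-isomorphic. Hence there are, up to isomorphism, exactly four groups $G$ fitting into an exact sequence $1\to A_6\to G\to\mu_4\to1$, and two such groups are isomorphic if and only if they have the same image $N$. -/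

import Mathlib

open scoped Pointwise MatrixGroups OnePoint

namespace A6Ext

/-- The alternating group of degree 6. -/
abbrev A6 : Type := alternatingGroup (Fin 6)

/-- The group of complex fourth roots of unity. -/
abbrev Mu4 : Type := rootsOfUnity 4 ℂ

/-- The generator `exp (2πi/4)` of `Mu4`. -/
noncomputable def zeta4 : Mu4 :=
  rootsOfUnity.mkOfPowEq (Complex.exp (2 * Real.pi * Complex.I / 4)) (by
    have h := (Complex.isPrimitiveRoot_exp 4 (by norm_num)).pow_eq_one
    simpa using h)

/-- The inner automorphisms of `A6`, i.e. `A6` viewed as a normal subgroup of `Aut(A6)`. -/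
def inn : Subgroup (MulAut A6) := (MulAut.conj : A6 →* MulAut A6).range

/-! ### The Mathieu groups of degree 12 and 10 -/

instance fact_prime_eleven : Fact (Nat.Prime 11) := ⟨by norm_num⟩

/-- The projective line over the field with 11 elements: the twelve points on which the Mathieu
group of degree 12 acts. -/
abbrev Points : Type := OnePoint (ZMod 11)

/-- The six-element set consisting of `∞` and the nonzero squares modulo 11. -/
def baseHexad : Set Points :=
  {∞, ((1 : ZMod 11) : Points), ((3 : ZMod 11) : Points), ((4 : ZMod 11) : Points),
    ((5 : ZMod 11) : Points), ((9 : ZMod 11) : Points)}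

/-- The 132 hexads of the Steiner system `S(5,6,12)`: the images of `baseHexad` under the Möbius
transformations of determinant 1. -/
def hexads : Set (Set Points) :=
  Set.range fun g : Matrix.SpecialLinearGroup (Fin 2) (ZMod 11) =>
    (fun x : Points => (g : GL (Fin 2) (ZMod 11)) • x) '' baseHexad

/-- The Mathieu group of degree 12, the automorphism group of the Steiner system `S(5,6,12)`. -/
def M12 : Subgroup (Equiv.Perm Points) := MulAction.stabilizer (Equiv.Perm Points) hexads

/-- The Mathieu group of degree 10, the pointwise stabilizer of two points in `M12`. -/
def M10 : Subgroup (Equiv.Perm Points) :=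
  M12 ⊓ fixingSubgroup (Equiv.Perm Points) {∞, ((0 : ZMod 11) : Points)}

/-! ### The four candidates for the image of the conjugation homomorphism -/

/-- Labels of the four groups `A₆`, `S₆`, `PGL(2,9)`, `M₁₀`. -/
inductive Kind : Type
  | A6
  | S6
  | PGL29
  | M10

/-- `N` is a subgroup of `Aut(A6)` isomorphic to the group labelled by the given kind. -/
def IsCandidate : Kind → Subgroup (MulAut A6) → Prop
  | .A6, N => Nonempty (N ≃* A6)
  | .S6, N => Nonempty (N ≃* Equiv.Perm (Fin 6))
  | .PGL29, N => Nonempty (N ≃* PGL(2, GaloisField 3 2))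
  | .M10, N => Nonempty (N ≃* A6Ext.M10)

/-- The admissible first components `g` of the generator `(g, zeta4)` for each kind of `N`:
the identity; conjugation by the transposition of the first two points; the fifth power of
an element of order 10 of `N`; an element of order 4 of `N` that is not inner. -/
def IsFirstComponent : Kind → Subgroup (MulAut A6) → MulAut A6 → Prop
  | .A6, _, g => g = 1
  | .S6, _, g => g = (MulAut.conjNormal (Equiv.swap (0 : Fin 6) 1) : MulAut A6)
  | .PGL29, N, g => ∃ h ∈ N, orderOf h = 10 ∧ g = h ^ 5
  | .M10, N, g => g ∈ N ∧ g ∉ inn ∧ orderOf g = 4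

/-! ### The model groups -/

/-- The element `(g, zeta4)` of `Aut(A6) × Mu4`. -/
noncomputable def lift (g : MulAut A6) : MulAut A6 × Mu4 := (g, zeta4)

/-- The subgroup of `Aut(A6) × Mu4` generated by `A6 × 1` and `(g, zeta4)`. -/
noncomputable def model (g : MulAut A6) : Subgroup (MulAut A6 × Mu4) :=
  inn.prod ⊥ ⊔ Subgroup.zpowers (lift g)

/-- The action of the cyclic group generated by `(g, zeta4)` on `A6` through the first component;
this is its conjugation action on `A6 × 1`. -/
noncomputable def action (g : MulAut A6) : Subgroup.zpowers (lift g) →* MulAut A6 :=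
  (MonoidHom.fst (MulAut A6) Mu4).comp (Subgroup.zpowers (lift g)).subtype

end A6Ext

namespace A6Ext
open Equiv

/-! ### The alternating group of degree six -/

/-! Structure of `Aut(A6)`. Up to conjugation by `S6`, an automorphism fixes a 5-cycle and sends a
fixed 3-cycle either to itself or to one product of two 3-cycles (`exists_symAut_mul`), so `S6` has
index at most 2 in `Aut(A6)`. A group of order at most 720 that contains `A6` and an element of
order 8 embeds in `Aut(A6)` by conjugation (`exists_injective_mulAut`). This applies to `M10` and
`PGL(2,9)`, and since `S6` has no element of order 8, the index is exactly 2. The element orders 8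
and 10 separate the three groups: `S6` has no element of order 8, `PGL(2,9)` has both orders, `M10`
has only 8. These are three distinct subgroups of index 2 that meet pairwise in `inn`, so every
square is inner, the outer automorphism group is a commutative group of order 4, and the three
subgroups cover `Aut(A6)`. As `A6` is perfect, every copy of it in `Aut(A6)` is `inn`, which gives
uniqueness of each subgroup (`isCandidate_iff`).

Extensions. Conjugation together with the projection embeds `G` in `Aut(A6) × Mu4`, because the
kernel `A6` of the projection has trivial center (`toProd_injective`). The image is generated by `A6
× 1` and `(c(x₀), zeta4)` for any lift `x₀` of `zeta4`, and depends only on the outer class of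
`c(x₀)` (`range_toProd`, `model_eq_model`). That class has order at most 2, so it is determined by
`N`. Conversely, an isomorphism of extensions preserves `A6`, since a perfect group has no
nontrivial map to `Mu4`. It therefore conjugates one image to the other in `Aut(A6)`, and conjugate
subgroups containing `inn` agree because the outer group is commutative
(`range_conjAct_le_of_equiv`). -/

instance isSimpleGroup_A6 : IsSimpleGroup A6 := alternatingGroup.isSimpleGroup (by simp)

theorem commutator_A6 : commutator A6 = ⊤ := commutator_alternatingGroup_eq_top (by simp)

theorem center_A6 : Subgroup.center A6 = ⊥ := alternatingGroup.center_eq_bot (by simp)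

theorem card_A6 : Nat.card A6 = 360 := by
  rw [nat_card_alternatingGroup, Nat.card_eq_fintype_card, Fintype.card_fin]
  decide

/-- A homomorphism from `A6` to a commutative group is trivial. -/
theorem hom_A6_eq_one {H : Type*} [CommGroup H] (f : A6 →* H) (a : A6) : f a = 1 := by
  have h : commutator A6 ≤ f.ker := Abelianization.commutator_subset_ker f
  rw [commutator_A6] at h
  exact h (Subgroup.mem_top a)

theorem hom_A6_injective {H : Type*} [Group H] (f : A6 →* H) (a : A6) (ha : f a ≠ 1) :
    Function.Injective f := by
  rw [← MonoidHom.ker_eq_bot_iff]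
  refine (IsSimpleGroup.eq_bot_or_eq_top_of_normal f.ker inferInstance).resolve_right fun h => ha ?_
  exact (h ▸ Subgroup.mem_top a : a ∈ f.ker)

theorem conj_A6_injective : Function.Injective (MulAut.conj : A6 →* MulAut A6) := by
  rw [← MonoidHom.ker_eq_bot_iff, eq_bot_iff, ← center_A6]
  intro a ha
  rw [Subgroup.mem_center_iff]
  intro b
  have := DFunLike.congr_fun (MonoidHom.mem_ker.1 ha) b
  rw [MulAut.conj_apply, MulAut.one_apply, mul_inv_eq_iff_eq_mul] at this
  exact this.symm

theorem mem_cycleType_le_six (σ : Perm (Fin 6)) {n : ℕ} (hn : n ∈ σ.cycleType) : n ≤ 6 :=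
  (σ.le_card_support_of_mem_cycleType hn).trans (Finset.card_le_univ _)

/-- The order is the lcm of cycle lengths between 2 and 6, hence divides 60. This is what separates
`S6` from `PGL(2,9)` and `M10`. -/
theorem orderOf_perm_six_ne_eight (σ : Perm (Fin 6)) : orderOf σ ≠ 8 := by
  intro h
  have : orderOf σ ∣ 60 := by
    rw [← σ.lcm_cycleType, Multiset.lcm_dvd]
    intro n hn
    have h1 := mem_cycleType_le_six σ hn
    have h2 := σ.two_le_of_mem_cycleType hn
    interval_cases n <;> norm_num
  rw [h] at this
  norm_num at this

/-- A 5-cycle leaves one point, so no other cycle fits beside it; without a 5-cycle the order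
divides 12. -/
theorem orderOf_perm_six_ne_ten (σ : Perm (Fin 6)) : orderOf σ ≠ 10 := by
  intro h
  by_cases h5 : 5 ∈ σ.cycleType
  · obtain ⟨s, hs⟩ := Multiset.exists_cons_of_mem h5
    have hsum : σ.cycleType.sum ≤ 6 := by
      rw [σ.sum_cycleType]; exact Finset.card_le_univ _
    have hs0 : s = 0 := by
      refine Multiset.eq_zero_of_forall_notMem fun n hn => ?_
      have h2 := σ.two_le_of_mem_cycleType (hs ▸ Multiset.mem_cons_of_mem hn)
      have h3 := Multiset.le_sum_of_mem hn
      rw [hs, Multiset.sum_cons] at hsum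
      omega
    rw [← σ.lcm_cycleType, hs, hs0] at h
    simp at h
  · have : orderOf σ ∣ 12 := by
      rw [← σ.lcm_cycleType, Multiset.lcm_dvd]
      intro n hn
      have h1 := mem_cycleType_le_six σ hn
      have h2 := σ.two_le_of_mem_cycleType hn
      interval_cases n <;> first | exact absurd hn h5 | norm_num
    rw [h] at this
    norm_num at this

theorem orderOf_A6_ne_eight (a : A6) : orderOf a ≠ 8 := by
  rw [← Subgroup.orderOf_coe]; exact orderOf_perm_six_ne_eight a

theorem orderOf_A6_ne_ten (a : A6) : orderOf a ≠ 10 := by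
  rw [← Subgroup.orderOf_coe]; exact orderOf_perm_six_ne_ten a

/-- The five-cycle `(0 1 2 3 4)`. -/
def fiveCycle : Perm (Fin 6) where
  toFun := ![1, 2, 3, 4, 0, 5]
  invFun := ![4, 0, 1, 2, 3, 5]
  left_inv := by decide
  right_inv := by decide

/-- The three-cycle `(0 1 5)`. -/
def threeCycle : Perm (Fin 6) where
  toFun := ![1, 5, 2, 3, 4, 0]
  invFun := ![5, 0, 2, 3, 4, 1]
  left_inv := by decide
  right_inv := by decide

/-- The product `(0 1 3)(2 4 5)`. -/
def doubleThreeCycle : Perm (Fin 6) where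
  toFun := ![1, 3, 4, 0, 5, 2]
  invFun := ![3, 0, 5, 1, 2, 4]
  left_inv := by decide
  right_inv := by decide

/-- The five-cycle as an element of `A6`. -/
def genA : A6 := ⟨fiveCycle, by rw [Perm.mem_alternatingGroup]; decide +kernel⟩

/-- The three-cycle as an element of `A6`. -/
def genB : A6 := ⟨threeCycle, by rw [Perm.mem_alternatingGroup]; decide +kernel⟩

/-- The product of two three-cycles as an element of `A6`. -/
def genC : A6 := ⟨doubleThreeCycle, by rw [Perm.mem_alternatingGroup]; decide +kernel⟩

/-- An exhaustive search over permutations `z`, given by their six values, with `x` the 5-cycle: the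
relations are `z³ = 1`, `(x z x³ z)³ = 1` and `(x⁴ z)⁵ = 1`. Distinctness is assumed value by value
so that the search prunes early. -/
theorem triple_candidates : ∀ a b : Fin 6, b ≠ a → ∀ c, c ≠ a → c ≠ b → ∀ d, d ≠ a → d ≠ b →
    d ≠ c → ∀ e, e ≠ a → e ≠ b → e ≠ c → e ≠ d → ∀ f, f ≠ a → f ≠ b → f ≠ c → f ≠ d → f ≠ e →
    let z : Fin 6 → Fin 6 := ![a, b, c, d, e, f]
    let x : Fin 6 → Fin 6 := fiveCycle
    (∀ i, z (z (z i)) = i) →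
    (∀ i, x (z (x (x (x (z (x (z (x (x (x (z (x (z (x (x (x (z i))))))))))))))))) = i) →
    ¬ (∀ i, z i = i) →
    (∀ i, (fun t => x (x (x (x (z t))))) ((fun t => x (x (x (x (z t)))))
      ((fun t => x (x (x (x (z t))))) ((fun t => x (x (x (x (z t)))))
      ((fun t => x (x (x (x (z t))))) i)))) = i) →
    ∃ k : Fin 5, (∀ i, z (fiveCycle^[k] i) = fiveCycle^[k] (threeCycle i)) ∨
      (∀ i, z (fiveCycle^[k] i) = fiveCycle^[k] (doubleThreeCycle i)) := by
  decide +kernel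

theorem closure_five_three_two_transitive : ∀ a b : Fin 6, a ≠ b → ∃ i j k : Fin 5,
    fiveCycle^[i] (threeCycle (fiveCycle^[j] (threeCycle (fiveCycle^[k] a)))) = 0 ∧
    fiveCycle^[i] (threeCycle (fiveCycle^[j] (threeCycle (fiveCycle^[k] b)))) = 1 := by
  decide +kernel

/-- Jordan's criterion: a primitive group containing a 3-cycle contains the alternating group.
Primitivity follows from 2-transitivity, obtained by moving every ordered pair to `(0, 1)`. -/
theorem alternatingGroup_le_closure :
    alternatingGroup (Fin 6) ≤ Subgroup.closure {fiveCycle, threeCycle} := by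
  set H := Subgroup.closure {fiveCycle, threeCycle} with hH
  have hx : fiveCycle ∈ H := Subgroup.subset_closure (by simp)
  have hy : threeCycle ∈ H := Subgroup.subset_closure (by simp)
  have key : ∀ a b : Fin 6, a ≠ b → ∃ g ∈ H, g a = 0 ∧ g b = 1 := by
    intro a b hab
    obtain ⟨i, j, k, h0, h1⟩ := closure_five_three_two_transitive a b hab
    refine ⟨fiveCycle ^ (i : ℕ) * threeCycle * fiveCycle ^ (j : ℕ) * threeCycle *
      fiveCycle ^ (k : ℕ), ?_, ?_, ?_⟩
    · exact mul_mem (mul_mem (mul_mem (mul_mem (pow_mem hx _) hy) (pow_mem hx _)) hy)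
        (pow_mem hx _)
    · simpa only [Perm.mul_apply, ← Perm.iterate_eq_pow] using h0
    · simpa only [Perm.mul_apply, ← Perm.iterate_eq_pow] using h1
  have h2 : MulAction.IsMultiplyPretransitive H (Fin 6) 2 := by
    rw [MulAction.is_two_pretransitive_iff]
    intro a b c d hab hcd
    obtain ⟨g, hg, ga, gb⟩ := key a b hab
    obtain ⟨k, hk, kc, kd⟩ := key c d hcd
    refine ⟨⟨k⁻¹ * g, mul_mem (inv_mem hk) hg⟩, ?_, ?_⟩
    · rw [Subgroup.mk_smul, Perm.smul_def, Perm.mul_apply, ga, Perm.inv_eq_iff_eq, kc]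
    · rw [Subgroup.mk_smul, Perm.smul_def, Perm.mul_apply, gb, Perm.inv_eq_iff_eq, kd]
  have := MulAction.isPreprimitive_of_is_two_pretransitive h2
  refine Perm.alternatingGroup_le_of_isPreprimitive_of_isThreeCycle_mem this (g := threeCycle) ?_ hy
  have : threeCycle = swap 1 0 * swap 1 5 := by decide
  rw [this]
  exact Perm.isThreeCycle_swap_mul_swap_same (by decide) (by decide) (by decide)

theorem closure_genA_genB : Subgroup.closure {genA, genB} = (⊤ : Subgroup A6) := by
  apply Subgroup.map_injective (Subgroup.subtype_injective _)
  rw [MonoidHom.map_closure, ← MonoidHom.range_eq_map, Subgroup.range_subtype, Set.image_pair]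
  refine le_antisymm ?_ alternatingGroup_le_closure
  rw [Subgroup.closure_le]
  rintro _ (rfl | rfl)
  · exact genA.2
  · exact genB.2

/-! ### Automorphisms of `A6` -/

/-- The action of the symmetric group on `A6` by conjugation. -/
def symAut : Perm (Fin 6) →* MulAut A6 := MulAut.conjNormal

theorem coe_symAut (σ : Perm (Fin 6)) (a : A6) : (symAut σ a : Perm (Fin 6)) = σ * a * σ⁻¹ :=
  MulAut.conjNormal_apply σ a

theorem symAut_coe (a : A6) : symAut a = MulAut.conj a := by
  ext b
  rw [coe_symAut]
  rfl

theorem cycleType_of_orderOf_five {σ : Perm (Fin 6)} (h : orderOf σ = 5) :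
    σ.cycleType = {5} := by
  obtain ⟨n, hn⟩ := Perm.cycleType_prime_order (σ := σ) (by rw [h]; norm_num)
  have hsum : σ.cycleType.sum ≤ 6 := by
    rw [σ.sum_cycleType]; exact Finset.card_le_univ _
  rw [hn, Multiset.sum_replicate, h] at hsum
  obtain rfl : n = 0 := by simp at hsum; omega
  simpa [h] using hn

theorem orderOf_genA : orderOf genA = 5 := by
  have : Fact (Nat.Prime 5) := ⟨by norm_num⟩
  refine orderOf_eq_prime ?_ ?_ <;> decide +kernel

theorem exists_conj_genB {z : Perm (Fin 6)} (h1 : z ≠ 1) (h2 : z * (z * z) = 1)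
    (h3 : ∀ i, fiveCycle (z (fiveCycle (fiveCycle (fiveCycle (z (fiveCycle (z (fiveCycle (fiveCycle
      (fiveCycle (z (fiveCycle (z (fiveCycle (fiveCycle (fiveCycle (z i))))))))))))))))) = i)
    (h4 : ∀ i, (fun t => fiveCycle (fiveCycle (fiveCycle (fiveCycle (z t)))))
      ((fun t => fiveCycle (fiveCycle (fiveCycle (fiveCycle (z t)))))
      ((fun t => fiveCycle (fiveCycle (fiveCycle (fiveCycle (z t)))))
      ((fun t => fiveCycle (fiveCycle (fiveCycle (fiveCycle (z t)))))
      ((fun t => fiveCycle (fiveCycle (fiveCycle (fiveCycle (z t))))) i)))) = i) :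
    ∃ k : ℕ, z = fiveCycle ^ k * threeCycle * (fiveCycle ^ k)⁻¹ ∨
      z = fiveCycle ^ k * doubleThreeCycle * (fiveCycle ^ k)⁻¹ := by
  have hz : ∀ {i j : Fin 6}, i ≠ j → z i ≠ z j := fun h => z.injective.ne h
  have key := triple_candidates (z 0) (z 1) (hz (by decide)) (z 2) (hz (by decide))
    (hz (by decide)) (z 3) (hz (by decide)) (hz (by decide)) (hz (by decide)) (z 4)
    (hz (by decide)) (hz (by decide)) (hz (by decide)) (hz (by decide)) (z 5) (hz (by decide))
    (hz (by decide)) (hz (by decide)) (hz (by decide)) (hz (by decide))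
  have hf : ![z 0, z 1, z 2, z 3, z 4, z 5] = z := by
    funext i; fin_cases i <;> rfl
  rw [hf] at key
  obtain ⟨k, hk⟩ := key (fun i => DFunLike.congr_fun h2 i) h3
    (fun h => h1 (Perm.ext h)) h4
  refine ⟨k, hk.imp (fun h => ?_) (fun h => ?_)⟩ <;>
  · rw [eq_mul_inv_iff_mul_eq]
    ext i
    rw [Perm.mul_apply, Perm.mul_apply, ← Perm.iterate_eq_pow, h i]

theorem mulAut_ext {φ ψ : MulAut A6} (hA : φ genA = ψ genA) (hB : φ genB = ψ genB) : φ = ψ := by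
  have : φ.toMonoidHom = ψ.toMonoidHom := by
    refine MonoidHom.eq_of_eqOn_dense closure_genA_genB ?_
    rintro _ (rfl | rfl)
    · exact hA
    · exact hB
  ext1 a
  exact DFunLike.congr_fun this a

/-- All elements of order 5 are 5-cycles, hence conjugate in `S6`, which normalizes the image of
`genA`. The image of `genB` then satisfies the relations of `triple_candidates`. -/
theorem exists_symAut_mul (φ : MulAut A6) : ∃ σ, (symAut σ * φ) genA = genA ∧
    ((symAut σ * φ) genB = genB ∨ (symAut σ * φ) genB = genC) := by
  have hconj : IsConj (φ genA : Perm (Fin 6)) fiveCycle := by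
    rw [Perm.isConj_iff_cycleType_eq, cycleType_of_orderOf_five, cycleType_of_orderOf_five]
    · rw [← orderOf_genA, ← Subgroup.orderOf_coe]; rfl
    · rw [Subgroup.orderOf_coe, MulEquiv.orderOf_eq, orderOf_genA]
  obtain ⟨τ, hτ⟩ := isConj_iff.1 hconj
  set ψ := symAut τ * φ with hψ
  have hA : ψ genA = genA := by
    apply Subtype.ext
    rw [hψ, MulAut.mul_apply, coe_symAut, hτ]; rfl
  have rel1 : genB * (genB * genB) = 1 := by decide +kernel
  have rel2 : genA * (genB * (genA * (genA * (genA * (genB * (genA * (genB * (genA * (genA * (genA *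
    (genB * (genA * (genB * (genA * (genA * (genA * genB)))))))))))))))) = 1 := by decide +kernel
  have rel3 : genA * (genA * (genA * (genA * (genB * (genA * (genA * (genA * (genA * (genB * (genA *
    (genA * (genA * (genA * (genB * (genA * (genA * (genA * (genA * (genB * (genA * (genA * (genA *
    (genA * genB))))))))))))))))))))))) = 1 := by decide +kernel
  have rel1' := congrArg ψ rel1
  have rel2' := congrArg ψ rel2
  have rel3' := congrArg ψ rel3
  simp only [map_mul, map_one, hA] at rel1' rel2' rel3'
  have hne : (ψ genB : Perm (Fin 6)) ≠ 1 := by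
    intro h
    have h' : ψ genB = 1 := Subtype.ext h
    rw [map_eq_one_iff _ ψ.injective] at h'
    revert h'
    decide +kernel
  obtain ⟨k, hk⟩ := exists_conj_genB hne (congrArg Subtype.val rel1')
    (fun i => DFunLike.congr_fun (congrArg Subtype.val rel2') i)
    (fun i => DFunLike.congr_fun (congrArg Subtype.val rel3') i)
  -- The remaining freedom is the centralizer of the 5-cycle: conjugating by its powers keeps `genA`
  -- fixed.
  refine ⟨(fiveCycle ^ k)⁻¹ * τ, ?_, ?_⟩
  · rw [map_mul, mul_assoc, MulAut.mul_apply, ← hψ, hA]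
    apply Subtype.ext
    rw [coe_symAut]
    change _ * fiveCycle * _ = fiveCycle
    rw [inv_inv, mul_assoc, inv_mul_eq_iff_eq_mul]
    exact ((Commute.refl fiveCycle).pow_right k).eq
  · rw [map_mul, mul_assoc, MulAut.mul_apply, ← hψ]
    refine hk.imp (fun h => ?_) (fun h => ?_) <;>
    · apply Subtype.ext
      rw [coe_symAut, h]
      simp only [mul_assoc, inv_inv, inv_mul_cancel, mul_one, inv_mul_cancel_left]
      rfl

/-- Outside `S6` only the second alternative for `genB` remains, so two such automorphisms agree on
generators after correction by `S6`. -/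
theorem mul_inv_mem_range_symAut {φ ψ : MulAut A6} (hφ : φ ∉ symAut.range)
    (hψ : ψ ∉ symAut.range) : φ * ψ⁻¹ ∈ symAut.range := by
  have key : ∀ χ : MulAut A6, χ ∉ symAut.range →
      ∃ σ, (symAut σ * χ) genA = genA ∧ (symAut σ * χ) genB = genC := by
    intro χ hχ
    obtain ⟨σ, hA, hB⟩ := exists_symAut_mul χ
    refine ⟨σ, hA, hB.resolve_left fun hB => hχ ⟨σ⁻¹, ?_⟩⟩
    rw [map_inv, inv_eq_iff_mul_eq_one]
    exact mulAut_ext hA hB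
  obtain ⟨σ, hA, hB⟩ := key φ hφ
  obtain ⟨τ, hA', hB'⟩ := key ψ hψ
  refine ⟨σ⁻¹ * τ, ?_⟩
  rw [map_mul, map_inv, eq_mul_inv_iff_mul_eq, mul_assoc, inv_mul_eq_iff_eq_mul]
  exact mulAut_ext (hA'.trans hA.symm) (hB'.trans hB.symm)

theorem symAut_injective : Function.Injective symAut := by
  rw [← MonoidHom.ker_eq_bot_iff, eq_bot_iff]
  intro σ hσ
  have hc : ∀ (a : A6) (i : Fin 6), σ ((a : Perm (Fin 6)) i) = (a : Perm (Fin 6)) (σ i) := by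
    intro a i
    have := coe_symAut σ a
    rw [MonoidHom.mem_ker.1 hσ, MulAut.one_apply, eq_mul_inv_iff_mul_eq] at this
    exact (DFunLike.congr_fun this i).symm
  have hA : ∀ i, σ (fiveCycle i) = fiveCycle (σ i) := hc genA
  -- A centralizing permutation preserves the unique fixed point 5 of the 5-cycle; the 3-cycle
  -- carries this to 0, and the 5-cycle to the other points.
  have h5 : σ 5 = 5 := by
    have : ∀ i, fiveCycle i = i → i = 5 := by decide
    exact this _ (hA 5).symm
  have h0 : σ 0 = 0 := by
    have : σ (threeCycle 5) = threeCycle (σ 5) := hc genB 5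
    rwa [h5] at this
  have h1 : σ 1 = 1 := by have := hA 0; rwa [h0] at this
  have h2 : σ 2 = 2 := by have := hA 1; rwa [h1] at this
  have h3 : σ 3 = 3 := by have := hA 2; rwa [h2] at this
  have h4 : σ 4 = 4 := by have := hA 3; rwa [h3] at this
  rw [Subgroup.mem_bot]
  ext i
  fin_cases i <;> simp [*]

/-! ### Groups of order 720 containing `A6` -/

/-- If a group acts on `Y` and the generators map the image of an injection `Z → Y` to itself, then
the group acts on `Z`. -/
theorem exists_permHom_of_generators {G Y Z : Type*} [Group G] (f : G →* Perm Y) (lab : Z → Y)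
    (hlab : Function.Injective lab) {S : Set G} (hS : Subgroup.closure S = ⊤)
    (h : ∀ s ∈ S, ∃ p : Perm Z, ∀ z, f s (lab z) = lab (p z)) :
    ∃ ψ : G →* Perm Z, ∀ g z, lab (ψ g z) = f g (lab z) := by
  have key : ∀ g : G, ∃ p : Perm Z, ∀ z, lab (p z) = f g (lab z) := by
    intro g
    have hg : g ∈ Subgroup.closure S := hS ▸ Subgroup.mem_top g
    induction hg using Subgroup.closure_induction with
    | mem s hs => obtain ⟨p, hp⟩ := h s hs; exact ⟨p, fun z => (hp z).symm⟩
    | one => exact ⟨1, fun z => by simp⟩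
    | mul a b _ _ ha hb =>
      obtain ⟨p, hp⟩ := ha
      obtain ⟨q, hq⟩ := hb
      exact ⟨p * q, fun z => by simp [hp, hq]⟩
    | inv a _ ha =>
      obtain ⟨p, hp⟩ := ha
      exact ⟨p⁻¹, fun z => by
        rw [map_inv, Perm.eq_inv_iff_eq, ← hp, ← Perm.mul_apply, mul_inv_cancel, Perm.one_apply]⟩
  choose p hp using key
  refine ⟨⟨⟨p, ?_⟩, ?_⟩, hp⟩
  · ext z; exact hlab (by simp [hp])
  · intro a b; ext z; exact hlab (by simp [hp])

theorem index_range_of_orderOf_eight {X : Type*} [Group X] [Finite X] (hX : Nat.card X ≤ 720)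
    (ι : A6 →* X) (hι : Function.Injective ι) {u : X} (hu : orderOf u = 8) :
    Nat.card X = 720 ∧ ι.range.index = 2 := by
  have hr : Nat.card ι.range = 360 := by
    rw [← card_A6]; exact (Nat.card_congr (MonoidHom.ofInjective hι).toEquiv).symm
  have hmul := ι.range.card_mul_index
  have hne : ι.range.index ≠ 1 := by
    rw [ne_eq, Subgroup.index_eq_one]
    intro htop
    obtain ⟨a, rfl⟩ : u ∈ ι.range := htop ▸ Subgroup.mem_top u
    rw [orderOf_injective ι hι] at hu
    exact orderOf_A6_ne_eight a hu
  have hpos : ι.range.index ≠ 0 := Subgroup.index_ne_zero_of_finite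
  rw [hr] at hmul
  have : ι.range.index = 2 := by omega
  exact ⟨by omega, this⟩

/-- A group of order at most 720 with a subgroup `A6` and an element of order 8 acts faithfully on
that subgroup by conjugation. -/
theorem exists_injective_mulAut {X : Type*} [Group X] [Finite X] (hX : Nat.card X ≤ 720)
    (ι : A6 →* X) (hι : Function.Injective ι) {u : X} (hu : orderOf u = 8) :
    ∃ c : X →* MulAut A6, Function.Injective c ∧ ∀ a, c (ι a) = MulAut.conj a := by
  obtain ⟨-, hidx⟩ := index_range_of_orderOf_eight hX ι hι hu
  have hn : ι.range.Normal := Subgroup.normal_of_index_eq_two hidx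
  have hur : u ∉ ι.range := by
    rintro ⟨a, rfl⟩
    rw [orderOf_injective ι hι] at hu
    exact orderOf_A6_ne_eight a hu
  let e : A6 ≃* ι.range := MonoidHom.ofInjective hι
  let c : X →* MulAut A6 := (MulAut.congr e.symm).toMonoidHom.comp MulAut.conjNormal
  have hc : ∀ x a, ι (c x a) = x * ι a * x⁻¹ := by
    intro x a
    have h1 : e (c x a) = MulAut.conjNormal x (e a) := by simp [c, MulAut.congr]
    have h2 := congrArg Subtype.val h1
    rwa [MulAut.conjNormal_apply] at h2
  refine ⟨c, ?_, fun a => ?_⟩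
  · rw [← MonoidHom.ker_eq_bot_iff, eq_bot_iff]
    intro x hx
    have hcomm : ∀ a, x * ι a = ι a * x := by
      intro a
      have := hc x a
      rw [MonoidHom.mem_ker.1 hx, MulAut.one_apply, eq_mul_inv_iff_mul_eq] at this
      exact this.symm
    have hcenter : ∀ a : A6, (∀ b, a * b = b * a) → a = 1 := by
      intro a ha
      have : a ∈ Subgroup.center A6 := Subgroup.mem_center_iff.2 fun b => (ha b).symm
      rwa [center_A6, Subgroup.mem_bot] at this
    have hmem : ∀ y ∈ ι.range, (∀ a, y * ι a = ι a * y) → y = 1 := by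
      rintro _ ⟨a, rfl⟩ ha
      rw [hcenter a fun b => hι (by simpa using ha b), map_one]
    rw [Subgroup.mem_bot]
    by_cases hxr : x ∈ ι.range
    · exact hmem x hxr hcomm
    · exfalso
      -- A nontrivial centralizing `x` would be an involution outside `A6`. Then `u = x * ι a` with
      -- commuting factors, and `u ^ 4 = ι (a ^ 4)` forces `a` to have order 8 in `A6`.
      have hx2 : x ^ 2 = 1 := hmem _ (Subgroup.sq_mem_of_index_two hidx x) fun a => by
        rw [pow_two, mul_assoc, hcomm, ← mul_assoc, hcomm, mul_assoc]
      obtain ⟨a, ha⟩ : x * u ∈ ι.range := by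
        rw [Subgroup.mul_mem_iff_of_index_two hidx]
        exact iff_of_false hxr hur
      have hua : u = x * ι a := by rw [ha, ← mul_assoc, ← pow_two, hx2, one_mul]
      have hx4 : x ^ 4 = 1 := by
        have := pow_mul x 2 2
        rwa [hx2, one_pow] at this
      have hu8 : u ^ (4 * 2) = 1 := by
        have := pow_orderOf_eq_one u
        rwa [hu] at this
      have hu4 : u ^ 4 = ι (a ^ 4) := by
        rw [hua, Commute.mul_pow (hcomm a), hx4, one_mul, map_pow]
      have ha8 : a ^ (4 * 2) = 1 := hι (by rw [map_one, pow_mul, map_pow, ← hu4, ← pow_mul, hu8])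
      have : a ^ 4 ≠ 1 := by
        intro h
        rw [h, map_one] at hu4
        have := orderOf_dvd_of_pow_eq_one hu4
        rw [hu] at this
        norm_num at this
      exact orderOf_A6_ne_eight a (orderOf_eq_prime_pow (p := 2) (n := 2) this ha8)
  · ext1 b
    apply hι
    rw [hc, MulAut.conj_apply, map_mul, map_mul, map_inv]

/-! ### The Mathieu group `M10` -/

/-- The translation `x ↦ x + 1` of the projective line. -/
def transl : Perm (Fin 12) where
  toFun := ![1, 2, 3, 4, 5, 6, 7, 8, 9, 10, 0, 11]
  invFun := ![10, 0, 1, 2, 3, 4, 5, 6, 7, 8, 9, 11]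
  left_inv := by decide
  right_inv := by decide

/-- The map `x ↦ -1/x` of the projective line. -/
def negInv : Perm (Fin 12) where
  toFun := ![11, 10, 5, 7, 8, 2, 9, 3, 4, 6, 1, 0]
  invFun := ![11, 10, 5, 7, 8, 2, 9, 3, 4, 6, 1, 0]
  left_inv := by decide
  right_inv := by decide

/-- The map `x ↦ 4x` of the projective line. -/
def dilat : Perm (Fin 12) where
  toFun := ![0, 4, 8, 1, 5, 9, 2, 6, 10, 3, 7, 11]
  invFun := ![0, 3, 6, 9, 1, 4, 7, 10, 2, 5, 8, 11]
  left_inv := by decide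
  right_inv := by decide

/-- An element of order 8 of `M10`. -/
def orderEight : Perm (Fin 12) where
  toFun := ![0, 2, 1, 6, 8, 9, 10, 5, 3, 4, 7, 11]
  invFun := ![0, 2, 1, 8, 9, 7, 3, 10, 4, 5, 6, 11]
  left_inv := by decide
  right_inv := by decide

/-- The action of `genA` on the labelled partitions. -/
def partA : Perm (Fin 12) where
  toFun := ![0, 2, 3, 7, 5, 9, 4, 10, 6, 8, 1, 11]
  invFun := ![0, 10, 1, 2, 6, 4, 8, 3, 9, 5, 7, 11]
  left_inv := by decide
  right_inv := by decide

/-- The action of `genB` on the labelled partitions. -/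
def partB : Perm (Fin 12) where
  toFun := ![0, 1, 8, 9, 6, 4, 5, 2, 7, 10, 3, 11]
  invFun := ![0, 1, 7, 10, 5, 6, 4, 8, 2, 3, 9, 11]
  left_inv := by decide
  right_inv := by decide

/-- The action of a six-cycle on the labelled partitions. -/
def partRot : Perm (Fin 12) where
  toFun := ![0, 7, 9, 2, 5, 3, 6, 10, 4, 8, 1, 11]
  invFun := ![0, 10, 3, 5, 8, 4, 6, 1, 9, 2, 7, 11]
  left_inv := by decide
  right_inv := by decide

/-- The action of a transposition on the labelled partitions. -/
def partSwap : Perm (Fin 12) where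
  toFun := ![0, 1, 8, 3, 4, 6, 5, 7, 2, 10, 9, 11]
  invFun := ![0, 1, 8, 3, 4, 6, 5, 7, 2, 10, 9, 11]
  left_inv := by decide
  right_inv := by decide

/-- The bit masks of the 132 hexads. -/
def masks : List ℕ := [
  2618, 1477, 807, 2701, 1817, 125, 723, 2379, 3095, 3681, 1195, 2481, 3188, 907, 1614, 3354,
  1587, 250, 1446, 2710, 2095, 3267, 343, 2914, 2281, 1814, 1181, 2613, 1127, 500, 845, 3372,
  2142, 2439, 686, 3780, 2514, 1581, 315, 3178, 207, 1000, 1690, 2649, 2236, 2830, 1372, 3465,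
  2980, 1115, 630, 2261, 414, 2000, 1333, 3250, 2424, 3612, 697, 2835, 3912, 183, 1260, 2474,
  828, 1953, 619, 2405, 2800, 3129, 1394, 3622, 3729, 366, 473, 2900, 1656, 1859, 1238, 2762,
  3552, 2163, 741, 3149, 3363, 732, 946, 3752, 1265, 1671, 429, 3476, 3009, 2278, 1482, 2203,
  2631, 1464, 1892, 3409, 483, 1295, 858, 2857, 3970, 2508, 917, 2358, 3214, 881, 1737, 2723,
  966, 543, 1716, 3666, 3845, 2968, 1834, 2668, 2333, 1762, 1427, 3398, 1932, 1086, 1385, 3237,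
  3595, 3888, 1621, 3288]

/-- Data separating the points outside the hexad `2095`. -/
def separators : List (Fin 12 × Fin 12 × ℕ × ℕ × Fin 12) := [
  (4, 6, 2618, 2613, 9), (4, 7, 2618, 2613, 9), (4, 8, 2618, 2613, 9), (4, 9, 183, 2236, 7),
  (4, 10, 2618, 2613, 9), (6, 4, 3149, 1127, 10), (6, 7, 3149, 1127, 10), (6, 8, 3149, 1127, 10),
  (6, 9, 3149, 1127, 10), (6, 10, 366, 2379, 8), (7, 4, 2701, 2723, 9), (7, 6, 2701, 2723, 9),
  (7, 8, 2701, 2723, 9), (7, 9, 2439, 429, 8), (7, 10, 2701, 2723, 9), (8, 4, 366, 2379, 6),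
  (8, 6, 2439, 429, 7), (8, 7, 366, 2379, 6), (8, 9, 366, 2379, 6), (8, 10, 366, 2379, 6),
  (9, 4, 2701, 2723, 7), (9, 6, 2701, 2723, 7), (9, 7, 2618, 2613, 4), (9, 8, 2701, 2723, 7),
  (9, 10, 2701, 2723, 7), (10, 4, 3149, 1127, 6), (10, 6, 1195, 3214, 7), (10, 7, 3149, 1127, 6),
  (10, 8, 3149, 1127, 6), (10, 9, 3149, 1127, 6)]

/-- The partitions of the six points into two triples, labelled by the points other than `0` and
`∞`. -/
def partitionOf : Fin 12 → Finset (Finset (Fin 6)) := ![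
  ∅,
  {{0, 1, 5}, {2, 3, 4}},
  {{0, 3, 4}, {1, 2, 5}},
  {{0, 1, 4}, {2, 3, 5}},
  {{0, 1, 3}, {2, 4, 5}},
  {{0, 3, 5}, {1, 2, 4}},
  {{0, 2, 4}, {1, 3, 5}},
  {{0, 1, 2}, {3, 4, 5}},
  {{0, 2, 5}, {1, 3, 4}},
  {{0, 2, 3}, {1, 4, 5}},
  {{0, 4, 5}, {1, 2, 3}},
  {Finset.univ}]

/-- The numbering of the projective line over the field with 11 elements. -/
def code : Points ≃ Fin 12 where
  toFun p := p.elim 11 fun k : ZMod 11 => Fin.castSucc (show Fin 11 from k)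
  invFun := ![((0 : ZMod 11) : Points), ((1 : ZMod 11) : Points), ((2 : ZMod 11) : Points),
    ((3 : ZMod 11) : Points), ((4 : ZMod 11) : Points), ((5 : ZMod 11) : Points),
    ((6 : ZMod 11) : Points), ((7 : ZMod 11) : Points), ((8 : ZMod 11) : Points),
    ((9 : ZMod 11) : Points), ((10 : ZMod 11) : Points), ∞]
  left_inv p := by
    induction p using OnePoint.rec with
    | infty => rfl
    | coe k => revert k; change ∀ k : Fin 11, _; intro k; fin_cases k <;> rfl
  right_inv i := by fin_cases i <;> rfl

/-- The set of points described by a bit mask. -/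
def hexad (n : ℕ) : Set Points := {p | n.testBit (code p)}

/-- The permutation of the projective line described by a permutation of the numbers. -/
def onPoints : Perm (Fin 12) ≃* Perm Points := code.symm.permCongrHom

theorem code_onPoints (q : Perm (Fin 12)) (p : Points) : code (onPoints q p) = q (code p) := by
  simp [onPoints, Equiv.permCongrHom, Equiv.permCongr_apply]

/-- The image of a bit mask under a permutation. -/
def imgMask (f : Perm (Fin 12)) (n : ℕ) : ℕ :=
  ((List.finRange 12).map fun i : Fin 12 => bif n.testBit i then 2 ^ (f i : ℕ) else 0).sum

/-- The permutation maps the listed masks to listed masks. -/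
def PreservesMasks (f : Perm (Fin 12)) : Prop :=
  ∀ n ∈ masks, imgMask f n ∈ masks ∧ ∀ i : Fin 12, (imgMask f n).testBit (f i) = n.testBit i

instance (f : Perm (Fin 12)) : Decidable (PreservesMasks f) := by
  unfold PreservesMasks; infer_instance

theorem preservesMasks_transl : PreservesMasks transl := by decide +kernel
theorem preservesMasks_negInv : PreservesMasks negInv := by decide +kernel
theorem preservesMasks_dilat : PreservesMasks dilat := by decide +kernel
theorem preservesMasks_orderEight : PreservesMasks orderEight := by decide +kernel
theorem preservesMasks_partA : PreservesMasks partA := by decide +kernel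
theorem preservesMasks_partB : PreservesMasks partB := by decide +kernel

theorem PreservesMasks.image_hexad {f : Perm (Fin 12)} (hf : PreservesMasks f) {n : ℕ}
    (hn : n ∈ masks) : onPoints f '' hexad n = hexad (imgMask f n) := by
  ext p
  rw [Equiv.image_eq_preimage_symm]
  obtain ⟨q, rfl⟩ := (onPoints f).surjective p
  simp only [Set.mem_preimage, Equiv.symm_apply_apply, hexad, Set.mem_ofPred_eq, code_onPoints,
    (hf n hn).2]

/-- Each of the 132 = 11 · (1 + 11) masks is the base mask moved by an explicit word in the two
Möbius maps, so each is a hexad. -/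
theorem masks_eq : masks = (List.range 11).flatMap fun s => (imgMask transl)^[s] 2618 ::
    (List.range 11).map fun t => (imgMask transl)^[s]
      (imgMask negInv ((imgMask transl)^[t] 2618)) := by
  decide +kernel

theorem baseHexad_eq : baseHexad = hexad 2618 := by
  ext p
  obtain ⟨i, rfl⟩ := code.symm.surjective p
  simp only [hexad, Set.mem_ofPred_eq, Equiv.apply_symm_apply, baseHexad, Set.mem_insert_iff,
    Set.mem_singleton_iff, Equiv.symm_apply_eq]
  revert i
  decide +kernel

/-- The matrix of determinant one with the given entries. -/
def slMk {K : Type*} [CommRing K] (a b c d : K) (h : a * d - b * c = 1) : SL(2, K) :=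
  ⟨!![a, b; c, d], by rw [Matrix.det_fin_two_of, h]⟩

theorem coe_slMk {K : Type*} [CommRing K] (a b c d : K) (h : a * d - b * c = 1) :
    (slMk a b c d h : Matrix (Fin 2) (Fin 2) K) = !![a, b; c, d] := rfl

theorem slMk_smul_infty {K : Type*} [Field K] [DecidableEq K] (a b c d : K)
    (h : a * d - b * c = 1) :
    (slMk a b c d h : GL (Fin 2) K) • (∞ : OnePoint K) = if c = 0 then ∞ else ((a / c : K) :) :=
  OnePoint.smul_infty_eq_ite _

theorem slMk_smul_coe {K : Type*} [Field K] [DecidableEq K] (a b c d : K)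
    (h : a * d - b * c = 1) (k : K) :
    (slMk a b c d h : GL (Fin 2) K) • (k : OnePoint K) =
      if c * k + d = 0 then ∞ else (((a * k + b) / (c * k + d) : K) :) :=
  OnePoint.smul_some_eq_ite

theorem sl_ext {K : Type*} [CommRing K] {g h : SL(2, K)}
    (H : (g : Matrix (Fin 2) (Fin 2) K) = h) : g = h := Subtype.ext H

/-- The unipotent matrix `x ↦ x + t`. -/
def slTransl (t : ZMod 11) : SL(2, ZMod 11) := slMk 1 t 0 1 (by simp)

/-- The matrix of `x ↦ -1/x`. -/
def slNegInv : SL(2, ZMod 11) := slMk 0 (-1) 1 0 (by simp)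

/-- The diagonal matrix of `x ↦ 4x`. -/
def slDilat : SL(2, ZMod 11) := slMk 2 0 0 6 (by decide)

theorem slTransl_smul (p : Points) :
    (slTransl 1 : GL (Fin 2) (ZMod 11)) • p = onPoints transl p := by
  apply code.injective
  rw [code_onPoints]
  induction p using OnePoint.rec with
  | infty => rw [slTransl, slMk_smul_infty, if_pos rfl]; rfl
  | coe k =>
    rw [slTransl, slMk_smul_coe, if_neg (by simp), zero_mul, zero_add, one_mul, div_one]
    revert k
    decide +kernel

theorem slDilat_smul (p : Points) :
    (slDilat : GL (Fin 2) (ZMod 11)) • p = onPoints dilat p := by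
  apply code.injective
  rw [code_onPoints]
  induction p using OnePoint.rec with
  | infty => rw [slDilat, slMk_smul_infty, if_pos rfl]; rfl
  | coe k =>
    have h6 : (6 : ZMod 11) ≠ 0 := by decide
    have h4 : 2 * k / 6 = 4 * k := by
      rw [div_eq_iff h6, mul_right_comm]; congr 1
    rw [slDilat, slMk_smul_coe, if_neg (by simpa using h6), zero_mul, zero_add, add_zero, h4]
    clear h4
    revert k
    decide +kernel

theorem slNegInv_smul (p : Points) :
    (slNegInv : GL (Fin 2) (ZMod 11)) • p = onPoints negInv p := by
  apply code.injective
  rw [code_onPoints]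
  induction p using OnePoint.rec with
  | infty =>
    rw [slNegInv, slMk_smul_infty, if_neg one_ne_zero, zero_div]
    decide +kernel
  | coe k =>
    rw [slNegInv, slMk_smul_coe, zero_mul, zero_add, add_zero, one_mul]
    have key : ∀ k : ZMod 11, k ≠ 0 → ∃ m : ZMod 11, m * k = -1 ∧
      code (m : Points) = negInv (code (k : Points)) := by decide +kernel
    split_ifs with hk
    · subst hk; decide +kernel
    · obtain ⟨m, hm, hc⟩ := key k hk
      rw [← hm, mul_div_cancel_right₀ _ hk, hc]

/-- The masks whose hexads are permuted by every element of `SL(2, 11)`. -/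
def slPreserves : Submonoid SL(2, ZMod 11) where
  carrier := {g | ∀ n ∈ masks, ∃ m ∈ masks,
    (fun x : Points => (g : GL (Fin 2) (ZMod 11)) • x) '' hexad n = hexad m}
  one_mem' n hn := ⟨n, hn, by simp⟩
  mul_mem' := by
    intro a b ha hb n hn
    obtain ⟨m, hm, h1⟩ := hb n hn
    obtain ⟨l, hl, h2⟩ := ha m hm
    refine ⟨l, hl, ?_⟩
    rw [← h2, ← h1, Set.image_image]
    simp only [map_mul, mul_smul]

theorem mem_slPreserves {g : SL(2, ZMod 11)} {f : Perm (Fin 12)}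
    (h : ∀ p : Points, (g : GL (Fin 2) (ZMod 11)) • p = onPoints f p) (hf : PreservesMasks f) :
    g ∈ slPreserves := by
  intro n hn
  refine ⟨imgMask f n, (hf n hn).1, ?_⟩
  simp only [h]
  exact hf.image_hexad hn

theorem slPreserves_eq_top : slPreserves = ⊤ := by
  have hU1 := mem_slPreserves slTransl_smul preservesMasks_transl
  have hW := mem_slPreserves slNegInv_smul preservesMasks_negInv
  have hD := mem_slPreserves slDilat_smul preservesMasks_dilat
  have hU : ∀ t, slTransl t ∈ slPreserves := by
    have : ∀ t : ZMod 11, ∃ k : Fin 11, slTransl t = slTransl 1 ^ (k : ℕ) := by decide +kernel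
    intro t
    obtain ⟨k, hk⟩ := this t
    exact hk ▸ pow_mem hU1 _
  -- 2 is a primitive root modulo 11 with inverse 6, so the powers of `slDilat` are all diagonal
  -- matrices of determinant one.
  have hd : ∀ (a e : ZMod 11) (h : a * e - 0 * 0 = 1), slMk a 0 0 e h ∈ slPreserves := by
    have : ∀ a e : ZMod 11, a * e - 0 * 0 = 1 → ∃ k : Fin 10,
        !![a, 0; 0, e] = ((slDilat ^ (k : ℕ) : SL(2, ZMod 11)) : Matrix _ _ (ZMod 11)) := by
      decide +kernel
    intro a e h
    obtain ⟨k, hk⟩ := this a e h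
    rw [show slMk a 0 0 e h = slDilat ^ (k : ℕ) from Subtype.ext hk]
    exact pow_mem hD _
  rw [eq_top_iff]
  intro g _
  have hdet := g.det_coe
  rw [Matrix.det_fin_two] at hdet
  have hg := Matrix.eta_fin_two (g : Matrix (Fin 2) (Fin 2) (ZMod 11))
  generalize (g : Matrix (Fin 2) (Fin 2) (ZMod 11)) 0 0 = a at hdet hg
  generalize (g : Matrix (Fin 2) (Fin 2) (ZMod 11)) 0 1 = b at hdet hg
  generalize (g : Matrix (Fin 2) (Fin 2) (ZMod 11)) 1 0 = c at hdet hg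
  generalize (g : Matrix (Fin 2) (Fin 2) (ZMod 11)) 1 1 = d at hdet hg
  -- Bruhat decomposition: the matrix is either upper triangular or lies in the big cell.
  by_cases h0 : c = 0
  · subst h0
    rw [mul_zero, sub_zero] at hdet
    have : g = slMk a 0 0 d (by simpa using hdet) * slTransl (b * d) := by
      apply sl_ext
      rw [Matrix.SpecialLinearGroup.coe_mul, hg]
      simp only [slTransl, coe_slMk, Matrix.mul_fin_two]
      congr! 3 <;> grind
    rw [this]
    exact mul_mem (hd _ _ _) (hU _)
  · have hce : c * c⁻¹ = 1 := mul_inv_cancel₀ h0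
    have : g = slTransl (a * c⁻¹) * slNegInv * slMk c 0 0 c⁻¹ (by simpa using hce) *
        slTransl (d * c⁻¹) := by
      apply sl_ext
      rw [Matrix.SpecialLinearGroup.coe_mul,
        Matrix.SpecialLinearGroup.coe_mul, Matrix.SpecialLinearGroup.coe_mul, hg]
      simp only [slTransl, slNegInv, coe_slMk, Matrix.mul_fin_two]
      congr! 3 <;> grind
    rw [this]
    exact mul_mem (mul_mem (mul_mem (hU _) hW) (hd _ _ _)) (hU _)

theorem hexads_eq : hexads = {H | ∃ n ∈ masks, H = hexad n} := by
  have hbase : 2618 ∈ masks := by decide +kernel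
  ext H
  constructor
  · rintro ⟨g, rfl⟩
    have hg : g ∈ slPreserves := slPreserves_eq_top ▸ Submonoid.mem_top g
    obtain ⟨m, hm, h⟩ := hg _ hbase
    exact ⟨m, hm, by rw [← h, baseHexad_eq]⟩
  · have step : ∀ {g : SL(2, ZMod 11)} {f : Perm (Fin 12)},
        (∀ p : Points, (g : GL (Fin 2) (ZMod 11)) • p = onPoints f p) → PreservesMasks f →
        ∀ n, (n ∈ masks ∧ hexad n ∈ hexads) → imgMask f n ∈ masks ∧ hexad (imgMask f n) ∈ hexads := by
      rintro g f h hf n ⟨hn, g', hg'⟩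
      refine ⟨(hf n hn).1, g * g', ?_⟩
      rw [← hf.image_hexad hn, ← hg', Set.image_image]
      simp only [map_mul, mul_smul, h]
    have iter : ∀ s n, (n ∈ masks ∧ hexad n ∈ hexads) →
        (imgMask transl)^[s] n ∈ masks ∧ hexad ((imgMask transl)^[s] n) ∈ hexads := by
      intro s
      induction s with
      | zero => exact fun n hn => hn
      | succ s ih =>
        intro n hn
        rw [Function.iterate_succ_apply]
        exact ih _ (step slTransl_smul preservesMasks_transl n hn)
    have hb : 2618 ∈ masks ∧ hexad 2618 ∈ hexads :=
      ⟨hbase, 1, by rw [← baseHexad_eq]; simp⟩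
    rintro ⟨n, hn, rfl⟩
    rw [masks_eq] at hn
    simp only [List.mem_flatMap, List.mem_cons, List.mem_map] at hn
    obtain ⟨s, -, rfl | ⟨t, -, rfl⟩⟩ := hn
    · exact (iter s _ hb).2
    · exact (iter s _ (step slNegInv_smul preservesMasks_negInv _ (iter t _ hb))).2

theorem hexad_mem_hexads {n : ℕ} (hn : n ∈ masks) : hexad n ∈ hexads := by
  rw [hexads_eq]; exact ⟨n, hn, rfl⟩

theorem finite_hexads : hexads.Finite := Set.toFinite _

theorem onPoints_mem_M12 {f : Perm (Fin 12)} (hf : PreservesMasks f) : onPoints f ∈ M12 := by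
  rw [M12, MulAction.mem_stabilizer_set' finite_hexads]
  intro H hH
  rw [hexads_eq] at hH
  obtain ⟨n, hn, rfl⟩ := hH
  have : onPoints f • hexad n = hexad (imgMask f n) := hf.image_hexad hn
  rw [this]
  exact hexad_mem_hexads (hf n hn).1

theorem onPoints_mem_M10 {f : Perm (Fin 12)} (hf : PreservesMasks f) (h0 : f 0 = 0)
    (h11 : f 11 = 11) : onPoints f ∈ M10 := by
  refine ⟨onPoints_mem_M12 hf, ?_⟩
  refine (mem_fixingSubgroup_iff _).2 ?_
  rintro p (rfl | rfl) <;>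
  · rw [Perm.smul_def]
    apply code.injective
    rw [code_onPoints]
    assumption

/-- The action of `M10` on the numbers of the points. -/
def numbers : M10 →* Perm (Fin 12) := onPoints.symm.toMonoidHom.comp M10.subtype

theorem numbers_injective : Function.Injective numbers :=
  onPoints.symm.injective.comp M10.subtype_injective

theorem onPoints_numbers (x : M10) : onPoints (numbers x) = x := onPoints.apply_symm_apply _

theorem numbers_mk {f : Perm (Fin 12)} (hf : onPoints f ∈ M10) : numbers ⟨_, hf⟩ = f :=
  onPoints.symm_apply_apply _

theorem numbers_code (x : M10) (p : Points) : numbers x (code p) = code ((x : Perm Points) p) := by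
  rw [← code_onPoints, onPoints_numbers]

theorem numbers_zero (x : M10) : numbers x 0 = 0 := by
  have h := (mem_fixingSubgroup_iff _).1 x.2.2 ((0 : ZMod 11) : Points) (by simp)
  have := numbers_code x ((0 : ZMod 11) : Points)
  rwa [show (x : Perm Points) ((0 : ZMod 11) : Points) = _ from h] at this

theorem numbers_eleven (x : M10) : numbers x 11 = 11 := by
  have h := (mem_fixingSubgroup_iff _).1 x.2.2 (∞ : Points) (by simp)
  have := numbers_code x ∞
  rwa [show (x : Perm Points) ∞ = _ from h] at this

theorem exists_mask_numbers (x : M10) {n : ℕ} (hn : n ∈ masks) :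
    ∃ m ∈ masks, ∀ i : Fin 12, m.testBit (numbers x i) = n.testBit i := by
  have h := (MulAction.mem_stabilizer_set.1 x.2.1 (hexad n)).2 (hexad_mem_hexads hn)
  rw [hexads_eq] at h
  obtain ⟨m, hm, hnm⟩ := h
  refine ⟨m, hm, fun i => ?_⟩
  obtain ⟨p, rfl⟩ := code.surjective i
  rw [numbers_code, Bool.eq_iff_iff]
  change (x : Perm Points) p ∈ hexad m ↔ p ∈ hexad n
  rw [← hnm, ← Perm.smul_def, Set.smul_mem_smul_set_iff]

/-! ### Sharpness of the action of `M10` on triples, and the bound 720 -/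

theorem mask_eq_of_testBit : ∀ m ∈ masks, m.testBit 0 = true → m.testBit 1 = true →
    m.testBit 2 = true → m.testBit 3 = true → m.testBit 11 = true → m = 2095 := by
  decide +kernel

theorem exists_separator : ∀ p v : Fin 12, Nat.testBit 2095 p = false →
    Nat.testBit 2095 v = false → p ≠ v → ∃ x ∈ separators, x.1 = p ∧ x.2.1 = v := by
  decide +kernel

/-- For an entry `(p, v, A, B, r)`, the hexads `A` and `B` share `p` and `r` outside the hexad
`2095`, while any hexads through `v` with the same traces on `2095` share only `v` there. A map
fixing `2095` pointwise hence cannot send `p` to `v`. -/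
theorem separator_spec : ∀ x ∈ separators, x.2.2.1 ∈ masks ∧ x.2.2.2.1 ∈ masks ∧
    x.2.2.1.testBit x.2.2.2.2 = true ∧ x.2.2.2.1.testBit x.2.2.2.2 = true ∧
    x.2.2.1.testBit x.1 = true ∧ x.2.2.2.1.testBit x.1 = true ∧
    Nat.testBit 2095 x.2.2.2.2 = false ∧ x.2.2.2.2 ≠ x.1 ∧
    ∀ C ∈ masks, C.testBit x.2.1 = true →
      (∀ i ∈ [0, 1, 2, 3, 5, 11], C.testBit i = x.2.2.1.testBit i) →
      ∀ D ∈ masks, D.testBit x.2.1 = true →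
        (∀ i ∈ [0, 1, 2, 3, 5, 11], D.testBit i = x.2.2.2.1.testBit i) →
        ∀ w : Fin 12, C.testBit w = true → D.testBit w = true →
          Nat.testBit 2095 w = false → w = x.2.1 := by
  decide +kernel

/-- An element of `M10` that fixes three further points is trivial. -/
theorem eq_one_of_numbers_fixed {x : M10} (h1 : numbers x 1 = 1) (h2 : numbers x 2 = 2)
    (h3 : numbers x 3 = 3) : x = 1 := by
  have h0 := numbers_zero x
  have h11 := numbers_eleven x
  set q := numbers x with hq
  have hH : ∀ i : Fin 12, Nat.testBit 2095 (q i) = Nat.testBit 2095 i := by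
    obtain ⟨m, hm, h⟩ := exists_mask_numbers x (n := 2095) (by decide +kernel)
    rw [← hq] at h
    have g0 := h 0
    have g1 := h 1
    have g2 := h 2
    have g3 := h 3
    have g11 := h 11
    rw [h0] at g0
    rw [h1] at g1
    rw [h2] at g2
    rw [h3] at g3
    rw [h11] at g11
    rwa [mask_eq_of_testBit m hm g0 g1 g2 g3 g11] at h
  -- The hexad `2095` is `{0, 1, 2, 3, 5, 11}`; it is preserved and its five other points are fixed.
  have h5 : q 5 = 5 := by
    have key : ∀ i : Fin 12, Nat.testBit 2095 i = true → i ≠ 0 → i ≠ 1 → i ≠ 2 → i ≠ 3 → i ≠ 11 →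
      i = 5 := by decide +kernel
    refine key _ (hH 5) ?_ ?_ ?_ ?_ ?_
    · exact fun h => absurd (q.injective (h.trans h0.symm)) (by decide)
    · exact fun h => absurd (q.injective (h.trans h1.symm)) (by decide)
    · exact fun h => absurd (q.injective (h.trans h2.symm)) (by decide)
    · exact fun h => absurd (q.injective (h.trans h3.symm)) (by decide)
    · exact fun h => absurd (q.injective (h.trans h11.symm)) (by decide)
  have trace : ∀ {C A : ℕ}, (∀ i : Fin 12, C.testBit (q i) = A.testBit i) →
      ∀ i ∈ [0, 1, 2, 3, 5, 11], C.testBit i = A.testBit i := by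
    intro C A h
    have g0 := h 0
    have g1 := h 1
    have g2 := h 2
    have g3 := h 3
    have g5 := h 5
    have g11 := h 11
    rw [h0] at g0
    rw [h1] at g1
    rw [h2] at g2
    rw [h3] at g3
    rw [h5] at g5
    rw [h11] at g11
    simp only [List.forall_mem_cons]
    exact ⟨g0, g1, g2, g3, g5, g11, by simp⟩
  have hout : ∀ p : Fin 12, Nat.testBit 2095 p = false → q p = p := by
    intro p hp
    by_contra hne
    obtain ⟨⟨p', v, A, B, r⟩, hs, hp', hv⟩ :=
      exists_separator p (q p) hp ((hH p).trans hp) (Ne.symm hne)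
    obtain ⟨hA, hB, hAr, hBr, hAp, hBp, hr, hrp, key⟩ := separator_spec _ hs
    dsimp only at hp' hv hA hB hAr hBr hAp hBp hr hrp key
    subst hp' hv
    obtain ⟨C, hC, hCA⟩ := exists_mask_numbers x hA
    obtain ⟨D, hD, hDB⟩ := exists_mask_numbers x hB
    rw [← hq] at hCA hDB
    -- `C` and `D` are the images of `A` and `B`, so the image of `r` must coincide with that of
    -- `p`.
    have := key C hC ((hCA _).trans hAp) (trace hCA) D hD ((hDB _).trans hBp) (trace hDB) (q r)
      ((hCA r).trans hAr) ((hDB r).trans hBr) ((hH r).trans hr)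
    exact hrp (q.injective this)
  have hin : ∀ i : Fin 12, Nat.testBit 2095 i = true →
      i = 0 ∨ i = 1 ∨ i = 2 ∨ i = 3 ∨ i = 5 ∨ i = 11 := by decide +kernel
  apply numbers_injective
  rw [map_one, ← hq]
  ext1 i
  rw [Perm.one_apply]
  cases hi : Nat.testBit 2095 i
  · exact hout i hi
  · rcases hin i hi with rfl | rfl | rfl | rfl | rfl | rfl <;> assumption

/-- An element is determined by the images of 1, 2, 3 among the ten moved points, and 10 · 9 · 8 =
720. -/
theorem card_M10_le : Nat.card M10 ≤ 720 := by
  let β := {i : Fin 12 // i ≠ 0 ∧ i ≠ 11}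
  let s : Fin 3 ↪ β := ⟨![⟨1, by decide⟩, ⟨2, by decide⟩, ⟨3, by decide⟩], by decide⟩
  let F : M10 → (Fin 3 ↪ β) := fun x =>
    ⟨fun i => ⟨numbers x (s i), fun h => (s i).2.1
      ((numbers x).injective (h.trans (numbers_zero x).symm)), fun h => (s i).2.2
      ((numbers x).injective (h.trans (numbers_eleven x).symm))⟩, fun i j h =>
      s.injective (Subtype.ext ((numbers x).injective (congrArg Subtype.val h)))⟩
  have hF : Function.Injective F := by
    intro x y h
    have key : ∀ i, numbers (y⁻¹ * x) (s i) = s i := by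
      intro i
      have : numbers x (s i) = numbers y (s i) :=
        congrArg Subtype.val (DFunLike.congr_fun h i)
      rw [map_mul, map_inv, Perm.mul_apply, Perm.inv_eq_iff_eq, this]
    exact (inv_mul_eq_one.1 (eq_one_of_numbers_fixed (key 0) (key 1) (key 2))).symm
  have hcard : Nat.card (Fin 3 ↪ β) = 720 := by
    rw [Nat.card_eq_fintype_card, Fintype.card_embedding_eq,
      show Fintype.card β = 10 by decide +kernel, Fintype.card_fin]
    rfl
  exact hcard ▸ Nat.card_le_card_of_injective F hF

/-! ### `A6` inside `M10`, acting on the ten partitions into two triples -/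

theorem partitionOf_injective : Function.Injective partitionOf := by decide +kernel

theorem finRotate_smul_partitionOf :
    ∀ i, finRotate 6 • partitionOf i = partitionOf (partRot i) := by decide +kernel

theorem swap_smul_partitionOf :
    ∀ i, swap (0 : Fin 6) 1 • partitionOf i = partitionOf (partSwap i) := by decide +kernel

theorem fiveCycle_smul_partitionOf :
    ∀ i, fiveCycle • partitionOf i = partitionOf (partA i) := by decide +kernel

theorem threeCycle_smul_partitionOf :
    ∀ i, threeCycle • partitionOf i = partitionOf (partB i) := by decide +kernel

theorem closure_finRotate_swap :
    Subgroup.closure {finRotate 6, swap (0 : Fin 6) 1} = ⊤ :=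
  Perm.closure_cycle_adjacent_swap isCycle_finRotate support_finRotate 0

/-- The action of the symmetric group on the labelled partitions. -/
theorem exists_partition_action : ∃ ψ : Perm (Fin 6) →* Perm (Fin 12),
    ψ fiveCycle = partA ∧ ψ threeCycle = partB ∧ ∀ σ, ψ σ 0 = 0 ∧ ψ σ 11 = 11 := by
  obtain ⟨ψ, hψ⟩ := exists_permHom_of_generators
    (MulAction.toPermHom (Perm (Fin 6)) (Finset (Finset (Fin 6)))) partitionOf
    partitionOf_injective closure_finRotate_swap (by
      rintro _ (rfl | rfl)
      · exact ⟨partRot, finRotate_smul_partitionOf⟩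
      · exact ⟨partSwap, swap_smul_partitionOf⟩)
  simp only [MulAction.toPermHom_apply, MulAction.toPerm_apply] at hψ
  refine ⟨ψ, ?_, ?_, fun σ => ⟨?_, ?_⟩⟩
  · ext1 i
    exact partitionOf_injective (by rw [hψ, fiveCycle_smul_partitionOf])
  · ext1 i
    exact partitionOf_injective (by rw [hψ, threeCycle_smul_partitionOf])
  -- The labels 0 and 11 carry the invariant families `∅` and `{univ}`, standing for the points `0`
  -- and `∞` that `M10` fixes.
  · exact partitionOf_injective (by rw [hψ]; exact Finset.smul_finset_empty σ)
  · refine partitionOf_injective ?_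
    rw [hψ]
    change σ • ({Finset.univ} : Finset (Finset (Fin 6))) = {Finset.univ}
    rw [Finset.smul_finset_singleton, Finset.smul_finset_univ]

theorem partA_fixed : ∀ i, partA i = i → i = 0 ∨ i = 11 := by decide +kernel

/-- To exclude order 10, count the fixed points of the involution `x ^ 5` modulo 5, using the
commuting element `x ^ 2` of order 5. -/
theorem M10_structure : ∃ (ι : A6 →* M10) (u w : M10), Function.Injective ι ∧ orderOf u = 8 ∧
    w ∉ ι.range ∧ orderOf w = 4 ∧ ∀ x : M10, orderOf x ≠ 10 := by
  obtain ⟨ψ, hA, hB, hfix⟩ := exists_partition_action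
  have hmemA : onPoints partA ∈ M10 :=
    onPoints_mem_M10 preservesMasks_partA (by decide +kernel) (by decide +kernel)
  have hmemB : onPoints partB ∈ M10 :=
    onPoints_mem_M10 preservesMasks_partB (by decide +kernel) (by decide +kernel)
  have hmemU : onPoints orderEight ∈ M10 :=
    onPoints_mem_M10 preservesMasks_orderEight (by decide +kernel) (by decide +kernel)
  let f : A6 →* Perm Points := onPoints.toMonoidHom.comp (ψ.comp (alternatingGroup (Fin 6)).subtype)
  have hf : ∀ a, f a ∈ M10 := by
    intro a
    have ha : a ∈ Subgroup.closure {genA, genB} := closure_genA_genB ▸ Subgroup.mem_top a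
    induction ha using Subgroup.closure_induction with
    | mem a h =>
      rcases h with rfl | rfl
      · exact (congrArg onPoints hA : f genA = _) ▸ hmemA
      · exact (congrArg onPoints hB : f genB = _) ▸ hmemB
    | one => rw [map_one]; exact one_mem _
    | mul a b _ _ h1 h2 => rw [map_mul]; exact mul_mem h1 h2
    | inv a _ h => rw [map_inv]; exact inv_mem h
  let ι : A6 →* M10 := f.codRestrict M10 hf
  have hnum : ∀ a, numbers (ι a) = ψ a := fun a => onPoints.symm_apply_apply _
  have hι : Function.Injective ι := by
    refine hom_A6_injective ι genA fun h => ?_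
    have := hnum genA
    rw [h, map_one] at this
    have h2 : (1 : Perm (Fin 12)) = partA := this.trans hA
    have h3 : (1 : Perm (Fin 12)) 1 ≠ partA 1 := by decide +kernel
    exact h3 (by rw [h2])
  let u : M10 := ⟨_, hmemU⟩
  have hnu : numbers u = orderEight := numbers_mk hmemU
  have hu : orderOf u = 8 := by
    rw [← orderOf_injective numbers numbers_injective, hnu]
    exact orderOf_eq_prime_pow (p := 2) (n := 2) (by decide +kernel) (by decide +kernel)
  have hur : u ∉ ι.range := by
    rintro ⟨a, ha⟩
    rw [← ha, orderOf_injective ι hι] at hu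
    exact orderOf_A6_ne_eight a hu
  obtain ⟨-, hidx⟩ := index_range_of_orderOf_eight card_M10_le ι hι hu
  refine ⟨ι, u, u * ι genA, hι, hu, ?_, ?_, ?_⟩
  · rwa [Subgroup.mul_mem_cancel_right _ (MonoidHom.mem_range.2 ⟨genA, rfl⟩)]
  · rw [← orderOf_injective numbers numbers_injective, map_mul, hnu, hnum,
      show ψ genA = partA from hA]
    exact orderOf_eq_prime_pow (p := 2) (n := 1) (by decide +kernel) (by decide +kernel)
  · intro x hx
    -- `A6` has no nontrivial sign, and the coset representative `u` is even, so `M10` acts by even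
    -- permutations.
    have hsign : ∀ y : M10, Perm.sign (numbers y) = 1 := by
      have h1 : ∀ y ∈ ι.range, Perm.sign (numbers y) = 1 := by
        rintro _ ⟨a, rfl⟩
        exact hom_A6_eq_one ((Perm.sign.comp numbers).comp ι) a
      have h2 : Perm.sign (numbers u) = 1 := by rw [hnu]; decide +kernel
      intro y
      by_cases hy : y ∈ ι.range
      · exact h1 y hy
      · have h3 := h1 (u * y) (by
          rw [Subgroup.mul_mem_iff_of_index_two hidx]; exact iff_of_false hur hy)
        rwa [map_mul, map_mul, h2, one_mul] at h3
    have hx10 : x ^ 10 = 1 := hx ▸ pow_orderOf_eq_one x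
    set t := numbers (x ^ 5) with ht
    set z := numbers (x ^ 2) with hz
    have htz : t * z = z * t := by
      rw [ht, hz, ← map_mul, ← map_mul, ← pow_add, ← pow_add]
    have ht2 : t ^ 2 = 1 := by
      rw [ht, ← map_pow, ← pow_mul, hx10, map_one]
    have ht1 : t ≠ 1 := by
      rw [ht, ne_eq, map_eq_one_iff _ numbers_injective]
      intro h
      have := orderOf_dvd_of_pow_eq_one h
      rw [hx] at this
      norm_num at this
    have hz5 : z ^ 5 ^ 1 = 1 := by
      rw [hz, pow_one, ← map_pow, ← pow_mul, hx10, map_one]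
    -- `x ^ 2` lies in `A6` and is conjugate in `S6` to the 5-cycle, which moves all ten partitions.
    have hzfix : ∀ i, z i = i → i = 0 ∨ i = 11 := by
      obtain ⟨a, ha⟩ := Subgroup.sq_mem_of_index_two hidx x
      have ha5 : orderOf (a : Perm (Fin 6)) = 5 := by
        rw [Subgroup.orderOf_coe, ← orderOf_injective ι hι, ha, orderOf_pow, hx]
        rfl
      have hza : z = ψ a := by rw [hz, ← ha, hnum]
      have hconj : IsConj (a : Perm (Fin 6)) fiveCycle := by
        rw [Perm.isConj_iff_cycleType_eq, cycleType_of_orderOf_five ha5,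
          cycleType_of_orderOf_five]
        rw [← orderOf_genA, ← Subgroup.orderOf_coe]; rfl
      obtain ⟨σ, hσ⟩ := isConj_iff.1 hconj
      intro i hi
      have key : partA (ψ σ i) = ψ σ i := by
        rw [← hA, ← hσ, map_mul, map_mul, map_inv, ← hza, Perm.mul_apply, Perm.mul_apply,
          ← Perm.mul_apply (ψ σ)⁻¹, inv_mul_cancel, Perm.one_apply, hi]
      refine (partA_fixed _ key).imp (fun h => ?_) (fun h => ?_)
      · exact (ψ σ).injective (h.trans (hfix σ).1.symm)
      · exact (ψ σ).injective (h.trans (hfix σ).2.symm)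
    have hsupp : t.support.card ≤ 10 := by
      have : t.support ⊆ Finset.univ \ {0, 11} := by
        intro i hi
        rw [Perm.mem_support] at hi
        simp only [Finset.mem_sdiff, Finset.mem_univ, Finset.mem_insert, Finset.mem_singleton,
          true_and]
        rintro (rfl | rfl)
        · exact hi (numbers_zero _)
        · exact hi (numbers_eleven _)
      exact (Finset.card_le_card this).trans (by decide +kernel)
    have hst := hsign (x ^ 5)
    rw [← ht, Perm.sign_of_pow_two_eq_one ht2, Perm.card_fixedPoints, Perm.sum_cycleType,
      Fintype.card_fin,
      Nat.sub_sub_self (hsupp.trans (by norm_num))] at hst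
    have h2s : 2 ∣ t.support.card := Perm.two_dvd_card_support ht2
    have hs0 : t.support.card ≠ 0 := by
      rwa [ne_eq, Perm.card_support_eq_zero]
    -- An even involution is a product of an even number of transpositions, here on at most ten
    -- points.
    have h48 : t.support.card = 4 ∨ t.support.card = 8 := by
      generalize t.support.card = n at hsupp hst h2s hs0
      interval_cases n <;> first | omega | (revert hst; decide)
    let p : Fin 12 → Prop := fun i => t i = i
    have hp : ∀ i, p (z i) ↔ p i := by
      intro i
      have : t (z i) = z (t i) := DFunLike.congr_fun htz i
      change t (z i) = z i ↔ t i = i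
      rw [this, z.injective.eq_iff]
    let zp := z.subtypePerm hp
    have hzp : zp ^ 5 ^ 1 = 1 := by
      ext i
      rw [Perm.subtypePerm_pow]
      change ((z ^ 5 ^ 1) i : ℕ) = i
      rw [hz5, Perm.one_apply]
    have : Fact (Nat.Prime 5) := ⟨by norm_num⟩
    have hmod := Perm.card_compl_support_modEq hzp
    have hc2 : zp.supportᶜ = {⟨0, numbers_zero _⟩, ⟨11, numbers_eleven _⟩} := by
      ext ⟨i, hi⟩
      simp only [Finset.mem_compl, Perm.notMem_support, Finset.mem_insert, Finset.mem_singleton,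
        Subtype.ext_iff, zp, Perm.subtypePerm_apply]
      refine ⟨hzfix i, ?_⟩
      rintro (rfl | rfl)
      · exact numbers_zero _
      · exact numbers_eleven _
    rw [hc2, Finset.card_pair (by simp)] at hmod
    have hcp : Fintype.card {i // p i} = 12 - t.support.card := by
      have := Finset.card_compl t.support
      rw [Fintype.card_fin] at this
      rw [Fintype.card_subtype, ← this]
      congr 1
      ext i
      simp [p]
    rw [hcp] at hmod
    -- The involution has 8 or 4 fixed points, but `z` acts on them with exactly two fixed points;
    -- neither number is 2 modulo 5.
    rcases h48 with h | h <;> rw [h] at hmod <;> exact absurd hmod (by decide)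

/-! ### The projective general linear group over the field with nine elements -/

/-- The field with nine elements. -/
abbrev F9 : Type := QuadraticAlgebra (ZMod 3) 2 0

/-- 2 = -1 is not a square modulo 3, so adjoining its square root gives a field, one in which finite
checks can be evaluated. -/
instance fact_F9 : Fact (∀ r : ZMod 3, r ^ 2 ≠ 2 + 0 * r) := ⟨by decide⟩

instance fintype_F9 : Fintype F9 := Fintype.ofEquiv _ (QuadraticAlgebra.equivProd 2 0).symm

theorem card_F9 : Fintype.card F9 = 9 := by decide +kernel

theorem mk_eq_one_iff {K : Type*} [Field K] (g : GL (Fin 2) K) :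
    (Matrix.ProjGenLinGroup.mk g : PGL(2, K)) = 1 ↔ g 0 1 = 0 ∧ g 1 0 = 0 ∧ g 0 0 = g 1 1 := by
  rw [Matrix.ProjGenLinGroup.mk_eq_one,
    Matrix.GeneralLinearGroup.mem_center_iff_val_mem_range_scalar]
  constructor
  · rintro ⟨s, hs⟩
    simp [← hs]
  · rintro ⟨h1, h2, h3⟩
    refine ⟨g 0 0, ?_⟩
    rw [Matrix.eta_fin_two (g : Matrix (Fin 2) (Fin 2) K), h1, h2, ← h3]
    ext i j
    fin_cases i <;> fin_cases j <;> simp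

/-- Fixing `∞` and `0` makes the matrix diagonal, and fixing `1` makes it scalar. This yields both
faithfulness and the bound 10 · 9 · 8 on the order. -/
theorem smul_eq_self_iff_center {K : Type*} [Field K] [DecidableEq K] (g : GL (Fin 2) K)
    (h0 : g • (∞ : OnePoint K) = ∞) (h1 : g • ((0 : K) : OnePoint K) = (0 : K))
    (h2 : g • ((1 : K) : OnePoint K) = (1 : K)) :
    (Matrix.ProjGenLinGroup.mk g : PGL(2, K)) = 1 := by
  rw [OnePoint.smul_infty_eq_self_iff] at h0
  rw [mk_eq_one_iff]
  rw [OnePoint.smul_some_eq_ite, h0] at h1 h2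
  simp only [mul_zero, zero_add, mul_one] at h1 h2
  have h11 : g 1 1 ≠ 0 := fun h => OnePoint.infty_ne_coe _ ((if_pos h).symm.trans h1)
  rw [if_neg h11] at h1 h2
  rw [OnePoint.coe_eq_coe, div_eq_iff h11] at h1 h2
  rw [zero_mul] at h1
  rw [h1, add_zero, one_mul] at h2
  exact ⟨h1, h0, h2⟩

theorem smul_of_mk_eq_one {K : Type*} [Field K] [DecidableEq K] (g : GL (Fin 2) K)
    (hg : (Matrix.ProjGenLinGroup.mk g : PGL(2, K)) = 1) (p : OnePoint K) : g • p = p := by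
  obtain ⟨h1, h2, h3⟩ := (mk_eq_one_iff g).1 hg
  have hne : g 1 1 ≠ 0 := by
    intro h
    have := g.det_ne_zero
    rw [Matrix.det_fin_two, h1, h] at this
    simp at this
  induction p using OnePoint.rec with
  | infty => rwa [OnePoint.smul_infty_eq_self_iff]
  | coe k =>
    rw [OnePoint.smul_some_eq_ite, h1, h2, h3, zero_mul, zero_add, add_zero, if_neg hne,
      mul_div_cancel_left₀ _ hne]

/-- The Möbius action of the projective general linear group on the projective line. -/
theorem exists_moebius_action (K : Type*) [Field K] [DecidableEq K] :
    ∃ Φ : PGL(2, K) →* Perm (OnePoint K), Function.Injective Φ ∧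
      ∀ g p, Φ (Matrix.ProjGenLinGroup.mk g) p = g • p := by
  let Θ : GL (Fin 2) K →* Perm (OnePoint K) := MulAction.toPermHom _ _
  have hle : Subgroup.center (GL (Fin 2) K) ≤ Θ.ker := by
    intro g hg
    rw [MonoidHom.mem_ker]
    ext1 p
    exact smul_of_mk_eq_one g (Matrix.ProjGenLinGroup.mk_eq_one.2 hg) p
  let Φ : PGL(2, K) →* Perm (OnePoint K) := QuotientGroup.lift _ Θ hle
  have hΦ : ∀ g p, Φ (Matrix.ProjGenLinGroup.mk g) p = g • p := fun g p => rfl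
  refine ⟨Φ, ?_, hΦ⟩
  rw [injective_iff_map_eq_one]
  intro x hx
  obtain ⟨g, rfl⟩ := Matrix.ProjGenLinGroup.mk_surjective x
  have hfix : ∀ p, g • p = p := fun p => by rw [← hΦ, hx, Perm.one_apply]
  exact smul_eq_self_iff_center g (hfix _) (hfix _) (hfix _)

theorem card_PGL_F9_le : Finite PGL(2, F9) ∧ Nat.card PGL(2, F9) ≤ 720 := by
  obtain ⟨Φ, hinj, hΦ⟩ := exists_moebius_action F9
  let s : Fin 3 ↪ OnePoint F9 :=
    ⟨![∞, ((0 : F9) : OnePoint F9), ((1 : F9) : OnePoint F9)], by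
      change Function.Injective (![none, some 0, some 1] : Fin 3 → Option F9)
      decide +kernel⟩
  let F : PGL(2, F9) → (Fin 3 ↪ OnePoint F9) := fun x => s.trans (Φ x).toEmbedding
  have hF : Function.Injective F := by
    intro x y h
    have key : ∀ i, Φ (y⁻¹ * x) (s i) = s i := by
      intro i
      have : Φ x (s i) = Φ y (s i) := DFunLike.congr_fun h i
      rw [map_mul, map_inv, Perm.mul_apply, Perm.inv_eq_iff_eq, this]
    obtain ⟨g, hg⟩ := Matrix.ProjGenLinGroup.mk_surjective (y⁻¹ * x)
    rw [← hg] at key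
    simp only [hΦ] at key
    have := smul_eq_self_iff_center g (key 0) (key 1) (key 2)
    rw [hg] at this
    exact (inv_mul_eq_one.1 this).symm
  have hcard : Nat.card (Fin 3 ↪ OnePoint F9) = 720 := by
    classical
    rw [Nat.card_eq_fintype_card, Fintype.card_embedding_eq, Fintype.card_fin,
      show Fintype.card (OnePoint F9) = 10 from
        (Fintype.card_option (α := F9)).trans (by rw [card_F9])]
    rfl
  exact ⟨Finite.of_injective F hF, hcard ▸ Nat.card_le_card_of_injective F hF⟩

/-- A labelling of the points of the projective line by partitions. -/
def lineLabel (p : OnePoint F9) : Fin 12 :=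
  p.elim 1 fun k => (![![2, 8, 7], ![9, 10, 3], ![6, 5, 4]] : Fin 3 → Fin 3 → Fin 12) k.im k.re

theorem lineLabel_injective : Function.Injective lineLabel := by
  change Function.Injective (fun p : Option F9 => lineLabel p)
  decide +kernel

/-- The matrix by which `genA` acts on the projective line. -/
def lineA : SL(2, F9) := slMk 0 1 2 ⟨1, 1⟩ (by decide +kernel)

/-- The matrix by which `genB` acts on the projective line. -/
def lineB : SL(2, F9) := slMk 1 1 0 1 (by decide +kernel)

theorem lineLabel_lineA (p : OnePoint F9) :
    partA (lineLabel p) = lineLabel ((lineA : GL (Fin 2) F9) • p) := by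
  induction p using OnePoint.rec with
  | infty =>
    rw [lineA, slMk_smul_infty, if_neg (by decide +kernel), zero_div]
    decide +kernel
  | coe k =>
    have key : ∀ k : F9, (2 * k + ⟨1, 1⟩ = 0 ∧ partA (lineLabel k) = lineLabel ∞) ∨
      ((2 : F9) * k + ⟨1, 1⟩ ≠ 0 ∧ ∃ m : F9, 0 * k + 1 = m * (2 * k + ⟨1, 1⟩) ∧
        partA (lineLabel k) = lineLabel m) := by decide +kernel
    rw [lineA, slMk_smul_coe]
    rcases key k with ⟨h, hl⟩ | ⟨h, m, hm, hl⟩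
    · rw [if_pos h, hl]
    · rw [if_neg h, hm, mul_div_cancel_right₀ _ h, hl]

theorem lineLabel_lineB (p : OnePoint F9) :
    partB (lineLabel p) = lineLabel ((lineB : GL (Fin 2) F9) • p) := by
  induction p using OnePoint.rec with
  | infty =>
    rw [lineB, slMk_smul_infty, if_pos rfl]
    decide +kernel
  | coe k =>
    have key : ∀ k : F9, partB (lineLabel k) = lineLabel (k + 1 : F9) := by decide +kernel
    rw [lineB, slMk_smul_coe, if_neg (by simp), zero_mul, zero_add, one_mul, div_one, key]

/-- A matrix whose class has order 8. -/
def glEight : GL (Fin 2) F9 := .mkOfDetNeZero !![⟨1, 1⟩, 0; 0, 1] (by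
  rw [Matrix.det_fin_two_of]; decide +kernel)

/-- A matrix whose class has order 10. -/
def glTen : GL (Fin 2) F9 := .mkOfDetNeZero !![0, 1; ⟨1, 1⟩, 1] (by
  rw [Matrix.det_fin_two_of]; decide +kernel)

/-- `lineLabel` identifies the projective line with the ten partitions so that `genA` and `genB` act
as Möbius maps. Faithfulness of the Möbius action then lifts `A6` into `PGL(2, F9)`. -/
theorem PGL_F9_structure : ∃ (ι : A6 →* PGL(2, F9)) (u h : PGL(2, F9)), Function.Injective ι ∧
    orderOf u = 8 ∧ orderOf h = 10 := by
  obtain ⟨Φ, hinj, hΦ⟩ := exists_moebius_action F9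
  obtain ⟨ψ, hA, hB, -⟩ := exists_partition_action
  obtain ⟨χ, hχ⟩ := exists_permHom_of_generators (ψ.comp (alternatingGroup (Fin 6)).subtype)
    lineLabel lineLabel_injective closure_genA_genB (by
      rintro _ (rfl | rfl)
      · exact ⟨Φ (Matrix.ProjGenLinGroup.mk lineA), fun z => by
          rw [hΦ, ← lineLabel_lineA, ← hA]; rfl⟩
      · exact ⟨Φ (Matrix.ProjGenLinGroup.mk lineB), fun z => by
          rw [hΦ, ← lineLabel_lineB, ← hB]; rfl⟩)
  have hχA : χ genA = Φ (Matrix.ProjGenLinGroup.mk lineA) := by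
    ext1 z
    apply lineLabel_injective
    rw [hχ, hΦ, ← lineLabel_lineA, ← hA]; rfl
  have hχB : χ genB = Φ (Matrix.ProjGenLinGroup.mk lineB) := by
    ext1 z
    apply lineLabel_injective
    rw [hχ, hΦ, ← lineLabel_lineB, ← hB]; rfl
  have hmem : ∀ a, χ a ∈ Φ.range := by
    intro a
    have ha : a ∈ Subgroup.closure {genA, genB} := closure_genA_genB ▸ Subgroup.mem_top a
    induction ha using Subgroup.closure_induction with
    | mem a h =>
      rcases h with rfl | rfl
      · exact ⟨_, hχA.symm⟩
      · exact ⟨_, hχB.symm⟩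
    | one => rw [map_one]; exact one_mem _
    | mul a b _ _ h1 h2 => rw [map_mul]; exact mul_mem h1 h2
    | inv a _ h => rw [map_inv]; exact inv_mem h
  let ι : A6 →* PGL(2, F9) :=
    (MonoidHom.ofInjective hinj).symm.toMonoidHom.comp (χ.codRestrict Φ.range hmem)
  have hι : ∀ a, Φ (ι a) = χ a := fun a => MonoidHom.apply_ofInjective_symm hinj ⟨χ a, hmem a⟩
  refine ⟨ι, .mk glEight, .mk glTen, ?_, ?_, ?_⟩
  · refine hom_A6_injective ι genB fun h => ?_
    have h1 := hι genB
    rw [h, map_one, hχB] at h1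
    have h2 := hinj ((map_one Φ).trans h1)
    have h3 := ((mk_eq_one_iff _).1 h2.symm).1
    exact one_ne_zero (α := F9) h3
  · refine orderOf_eq_prime_pow (p := 2) (n := 2) ?_ ?_ <;>
    · rw [← map_pow, mk_eq_one_iff, Units.val_pow_eq_pow_val]
      decide +kernel
  · refine orderOf_eq_of_pow_and_pow_div_prime (by norm_num) ?_ fun p hp hd => ?_
    · rw [← map_pow, mk_eq_one_iff, Units.val_pow_eq_pow_val]
      decide +kernel
    · have : p = 2 ∨ p = 5 := by
        have : p ∈ Nat.primeFactors 10 := Nat.mem_primeFactors.2 ⟨hp, hd, by norm_num⟩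
        rwa [show Nat.primeFactors 10 = {2, 5} by decide +kernel, Finset.mem_insert,
          Finset.mem_singleton] at this
      rcases this with rfl | rfl <;>
      · rw [ne_eq, ← map_pow, mk_eq_one_iff, Units.val_pow_eq_pow_val]
        decide +kernel

theorem nonempty_PGL_equiv : Nonempty (PGL(2, F9) ≃* PGL(2, GaloisField 3 2)) := by
  have : Fintype (GaloisField 3 2) := Fintype.ofFinite _
  have hcard : Fintype.card F9 = Fintype.card (GaloisField 3 2) := by
    rw [card_F9, ← Nat.card_eq_fintype_card, GaloisField.card 3 2 (by norm_num)]
    norm_num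
  let e := FiniteField.ringEquivOfCardEq hcard
  let E : GL (Fin 2) F9 ≃* GL (Fin 2) (GaloisField 3 2) := Units.mapEquiv e.mapMatrix.toMulEquiv
  have hE : (Subgroup.center (GL (Fin 2) F9)).map E.toMonoidHom =
      Subgroup.center (GL (Fin 2) (GaloisField 3 2)) := by
    ext g
    rw [Subgroup.mem_map_equiv, Subgroup.mem_center_iff, Subgroup.mem_center_iff]
    refine ⟨fun h x => ?_, fun h x => ?_⟩
    · apply E.symm.injective
      rw [map_mul, map_mul, h]
    · apply E.injective
      rw [map_mul, map_mul, E.apply_symm_apply, h]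
  exact ⟨QuotientGroup.congr _ _ E hE⟩

/-! ### Subgroups of `Aut(A6)` containing the inner automorphisms -/

instance finite_mulAut : Finite (MulAut A6) := DFunLike.finite _

instance normal_inn : inn.Normal where
  conj_mem := by
    rintro _ ⟨a, rfl⟩ g
    refine ⟨g a, ?_⟩
    ext1 b
    simp [MulAut.conj_apply, MulAut.mul_apply]

theorem card_inn : Nat.card inn = 360 := by
  rw [← card_A6]
  exact (Nat.card_congr (MonoidHom.ofInjective conj_A6_injective).toEquiv).symm

/-- `inn` has index 2 in `N`, so no subgroup lies strictly between. -/
theorem eq_inn_or_eq_of_le {M N : Subgroup (MulAut A6)} (hN : Nat.card N = 720) (h1 : inn ≤ M)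
    (h2 : M ≤ N) : M = inn ∨ M = N := by
  have hd1 := Subgroup.card_dvd_of_le h1
  have hd2 := Subgroup.card_dvd_of_le h2
  rw [hN] at hd2
  rw [card_inn] at hd1
  obtain ⟨c, hc⟩ := hd1
  have hle := Nat.le_of_dvd (by norm_num) hd2
  have hpos : 0 < Nat.card M := Nat.card_pos
  have : c = 1 ∨ c = 2 := by omega
  rcases this with rfl | rfl
  · exact Or.inl (Subgroup.eq_of_le_of_card_ge h1 (by rw [card_inn, hc])).symm
  · exact Or.inr (Subgroup.eq_of_le_of_card_ge h2 (by rw [hN, hc]))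

theorem inf_eq_inn {M N : Subgroup (MulAut A6)} (hM : Nat.card M = 720) (hN : Nat.card N = 720)
    (h1 : inn ≤ M) (h2 : inn ≤ N) (hne : M ≠ N) : M ⊓ N = inn := by
  refine (eq_inn_or_eq_of_le hN (le_inf h1 h2) inf_le_right).resolve_right fun h => hne ?_
  exact (Subgroup.eq_of_le_of_card_ge (inf_eq_right.1 h) (by rw [hM, hN])).symm

theorem inn_le_range_symAut : inn ≤ symAut.range := by
  rintro _ ⟨a, rfl⟩
  exact ⟨a, symAut_coe a⟩

theorem card_range_symAut : Nat.card symAut.range = 720 := by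
  rw [← Nat.card_congr (MonoidHom.ofInjective symAut_injective).toEquiv, Nat.card_perm,
    Nat.card_eq_fintype_card, Fintype.card_fin]
  rfl

/-- Groups of order 720 containing `A6` and an element of order 8 are subgroups of `Aut(A6)`. -/
theorem exists_subgroup_equiv {X : Type*} [Group X] [Finite X] (hX : Nat.card X ≤ 720)
    (ι : A6 →* X) (hι : Function.Injective ι) {u : X} (hu : orderOf u = 8) :
    ∃ (N : Subgroup (MulAut A6)) (e : X ≃* N), inn ≤ N ∧ Nat.card N = 720 ∧
      ∀ a, (e (ι a) : MulAut A6) = MulAut.conj a := by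
  obtain ⟨c, hc, hca⟩ := exists_injective_mulAut hX ι hι hu
  refine ⟨c.range, MonoidHom.ofInjective hc, ?_, ?_, hca⟩
  · rintro _ ⟨a, rfl⟩
    exact ⟨ι a, hca a⟩
  · rw [← Nat.card_congr (MonoidHom.ofInjective hc).toEquiv]
    exact (index_range_of_orderOf_eight hX ι hι hu).1

instance finite_M10 : Finite M10 := by
  have : Finite Points := Finite.of_equiv _ code.symm
  infer_instance

theorem exists_image : ∃ image : Kind → Subgroup (MulAut A6),
    (∀ k, IsCandidate k (image k)) ∧ (∀ k, inn ≤ image k) ∧ (∀ k, k ≠ .A6 → Nat.card (image k) = 720) ∧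
    image .A6 = inn ∧ image .S6 = symAut.range ∧
    (∃ g ∈ image .PGL29, orderOf g = 8) ∧ (∃ g ∈ image .PGL29, orderOf g = 10) ∧
    (∃ g ∈ image .M10, orderOf g = 8) ∧ (∀ g ∈ image .M10, orderOf g ≠ 10) ∧
    ∃ g ∈ image .M10, g ∉ inn ∧ orderOf g = 4 := by
  obtain ⟨hfin, hle⟩ := card_PGL_F9_le
  obtain ⟨ι, u, h, hι, hu, hh⟩ := PGL_F9_structure
  obtain ⟨P, e, hP, hcP, -⟩ := exists_subgroup_equiv hle ι hι hu
  obtain ⟨j⟩ := nonempty_PGL_equiv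
  obtain ⟨ι', u', w, hι', hu', hw, hw4, h10⟩ := M10_structure
  obtain ⟨M, e', hM, hcM, he'⟩ := exists_subgroup_equiv card_M10_le ι' hι' hu'
  refine ⟨fun k => match k with
    | .A6 => inn
    | .S6 => symAut.range
    | .PGL29 => P
    | .M10 => M, ?_, ?_, ?_, rfl, rfl, ?_, ?_, ?_, ?_, ?_⟩
  · rintro (_ | _ | _ | _)
    · exact ⟨(MonoidHom.ofInjective conj_A6_injective).symm⟩
    · exact ⟨(MonoidHom.ofInjective symAut_injective).symm⟩
    · exact ⟨e.symm.trans j⟩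
    · exact ⟨e'.symm⟩
  · rintro (_ | _ | _ | _)
    exacts [le_rfl, inn_le_range_symAut, hP, hM]
  · rintro (_ | _ | _ | _) hk
    exacts [absurd rfl hk, card_range_symAut, hcP, hcM]
  · exact ⟨e u, (e u).2, by rw [Subgroup.orderOf_coe, MulEquiv.orderOf_eq, hu]⟩
  · exact ⟨e h, (e h).2, by rw [Subgroup.orderOf_coe, MulEquiv.orderOf_eq, hh]⟩
  · exact ⟨e' u', (e' u').2, by rw [Subgroup.orderOf_coe, MulEquiv.orderOf_eq, hu']⟩
  · intro g hg
    rw [← Subgroup.orderOf_mk g hg, ← MulEquiv.orderOf_eq e'.symm]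
    exact h10 _
  · refine ⟨e' w, (e' w).2, ?_, by rw [Subgroup.orderOf_coe, MulEquiv.orderOf_eq, hw4]⟩
    rintro ⟨a, ha⟩
    refine hw ⟨a, e'.injective (Subtype.ext ?_)⟩
    rw [he', ha]

/-- The subgroup of `Aut(A6)` of the given kind. -/
noncomputable def image : Kind → Subgroup (MulAut A6) := exists_image.choose

theorem isCandidate_image (k : Kind) : IsCandidate k (image k) := exists_image.choose_spec.1 k
theorem inn_le_image (k : Kind) : inn ≤ image k := exists_image.choose_spec.2.1 k
theorem card_image {k : Kind} (hk : k ≠ .A6) : Nat.card (image k) = 720 :=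
  exists_image.choose_spec.2.2.1 k hk
theorem image_A6 : image .A6 = inn := exists_image.choose_spec.2.2.2.1
theorem image_S6 : image .S6 = symAut.range := exists_image.choose_spec.2.2.2.2.1
theorem exists_eight_image_PGL29 : ∃ g ∈ image .PGL29, orderOf g = 8 :=
  exists_image.choose_spec.2.2.2.2.2.1
theorem exists_ten_image_PGL29 : ∃ g ∈ image .PGL29, orderOf g = 10 :=
  exists_image.choose_spec.2.2.2.2.2.2.1
theorem exists_eight_image_M10 : ∃ g ∈ image .M10, orderOf g = 8 :=
  exists_image.choose_spec.2.2.2.2.2.2.2.1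
theorem orderOf_ne_ten_of_mem_image_M10 : ∀ g ∈ image .M10, orderOf g ≠ 10 :=
  exists_image.choose_spec.2.2.2.2.2.2.2.2.1
theorem exists_outer_image_M10 : ∃ g ∈ image .M10, g ∉ inn ∧ orderOf g = 4 :=
  exists_image.choose_spec.2.2.2.2.2.2.2.2.2

theorem orderOf_ne_eight_of_mem_image_S6 : ∀ g ∈ image .S6, orderOf g ≠ 8 := by
  rw [image_S6]
  rintro _ ⟨σ, rfl⟩
  rw [orderOf_injective symAut symAut_injective]
  exact orderOf_perm_six_ne_eight σ

theorem orderOf_map_equiv {M N : Subgroup (MulAut A6)} (e : M ≃* N) {n : ℕ}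
    (h : ∃ g ∈ M, orderOf g = n) : ∃ g ∈ N, orderOf g = n := by
  obtain ⟨g, hg, hn⟩ := h
  exact ⟨e ⟨g, hg⟩, (e _).2, by rw [Subgroup.orderOf_coe, MulEquiv.orderOf_eq, Subgroup.orderOf_mk, hn]⟩

/-- The four subgroups are pairwise not isomorphic. -/
theorem eq_of_image_equiv {k k' : Kind} (e : image k ≃* image k') : k = k' := by
  have hcard := Nat.card_congr e.toEquiv
  have hA : ∀ {k}, k ≠ .A6 → Nat.card (image .A6) ≠ Nat.card (image k) := by
    intro k hk
    rw [card_image hk, image_A6, card_inn]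
    norm_num
  by_cases h : k = .A6
  · subst h
    by_contra hne
    exact hA (Ne.symm hne) hcard
  by_cases h' : k' = .A6
  · subst h'
    exact absurd hcard.symm (hA h)
  have no8 : ¬ ∃ g ∈ image .S6, orderOf g = 8 := fun ⟨g, hg, hn⟩ =>
    orderOf_ne_eight_of_mem_image_S6 g hg hn
  have no10 : ¬ ∃ g ∈ image .M10, orderOf g = 10 := fun ⟨g, hg, hn⟩ =>
    orderOf_ne_ten_of_mem_image_M10 g hg hn
  cases k <;> cases k' <;> first
    | rfl
    | exact absurd rfl h
    | exact absurd rfl h'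
    | exact absurd (orderOf_map_equiv e exists_eight_image_PGL29) no8
    | exact absurd (orderOf_map_equiv e exists_eight_image_M10) no8
    | exact absurd (orderOf_map_equiv e.symm exists_eight_image_PGL29) no8
    | exact absurd (orderOf_map_equiv e.symm exists_eight_image_M10) no8
    | exact absurd (orderOf_map_equiv e exists_ten_image_PGL29) no10
    | exact absurd (orderOf_map_equiv e.symm exists_ten_image_PGL29) no10

theorem image_injective : Function.Injective image := fun _ _ h =>
  eq_of_image_equiv (MulEquiv.subgroupCongr h)

theorem inf_image {k k' : Kind} (h : k ≠ .A6) (h' : k' ≠ .A6) (hne : k ≠ k') :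
    image k ⊓ image k' = inn :=
  inf_eq_inn (card_image h) (card_image h') (inn_le_image k) (inn_le_image k')
    (image_injective.ne hne)

/-! ### The order of `Aut(A6)` and its outer quotient -/

theorem card_mulAut : Nat.card (MulAut A6) = 1440 := by
  have hidx : (image .S6).index = 2 := by
    obtain ⟨g, hg, hn⟩ := exists_eight_image_M10
    have hgS : g ∉ image .S6 := fun h => orderOf_ne_eight_of_mem_image_S6 g h hn
    rw [Subgroup.index_eq_two_iff]
    refine ⟨g⁻¹, fun b => ?_⟩
    by_cases hb : b ∈ image .S6
    · refine Or.inr ⟨hb, fun h => hgS ?_⟩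
      rwa [Subgroup.mul_mem_cancel_left _ hb, inv_mem_iff] at h
    · refine Or.inl ⟨?_, hb⟩
      rw [image_S6] at hb hgS ⊢
      exact mul_inv_mem_range_symAut hb hgS
  rw [← Subgroup.card_mul_index (image .S6), hidx, card_image (by simp)]

theorem index_image {k : Kind} (hk : k ≠ .A6) : (image k).index = 2 := by
  have := (image k).card_mul_index
  rw [card_image hk, card_mulAut] at this
  omega

/-- A square lies in every subgroup of index 2, and two of these meet in `inn`. -/
theorem sq_mem_inn (g : MulAut A6) : g ^ 2 ∈ inn := by
  rw [← inf_image (k := .S6) (k' := .PGL29) (by simp) (by simp) (by simp)]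
  exact ⟨Subgroup.sq_mem_of_index_two (index_image (by simp)) g,
    Subgroup.sq_mem_of_index_two (index_image (by simp)) g⟩

/-- The outer automorphism group of `A6` is commutative. -/
theorem outer_mul_comm (x y : MulAut A6 ⧸ inn) : x * y = y * x := by
  have hsq : ∀ z : MulAut A6 ⧸ inn, z⁻¹ = z := by
    intro z
    obtain ⟨g, rfl⟩ := QuotientGroup.mk_surjective z
    rw [inv_eq_iff_mul_eq_one, ← pow_two, ← QuotientGroup.mk_pow, QuotientGroup.eq_one_iff]
    exact sq_mem_inn g
  rw [← hsq (x * y), mul_inv_rev, hsq, hsq]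

/-- The perfect group `A6` dies in the commutative outer quotient. -/
theorem hom_A6_mem_inn (f : A6 →* MulAut A6) (a : A6) : f a ∈ inn := by
  let _ : CommGroup (MulAut A6 ⧸ inn) := { (inferInstance : Group (MulAut A6 ⧸ inn)) with
    mul_comm := outer_mul_comm }
  rw [← QuotientGroup.eq_one_iff]
  exact hom_A6_eq_one ((QuotientGroup.mk' inn).comp f) a

theorem conj_mem_of_inn_le {N : Subgroup (MulAut A6)} (hN : inn ≤ N) {n : MulAut A6} (hn : n ∈ N)
    (g : MulAut A6) : g * n * g⁻¹ ∈ N := by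
  have h : g * n * g⁻¹ * n⁻¹ ∈ inn := by
    rw [← QuotientGroup.eq_one_iff]
    simp only [QuotientGroup.mk_mul, QuotientGroup.mk_inv]
    rw [outer_mul_comm (g : MulAut A6 ⧸ inn)]
    simp
  simpa using mul_mem (hN h) hn

/-- Every automorphism lies in one of the three subgroups of index two. -/
theorem exists_mem_image (g : MulAut A6) : ∃ k, k ≠ .A6 ∧ g ∈ image k := by
  by_contra! h
  have hS := h .S6 (by simp)
  have hP := h .PGL29 (by simp)
  obtain ⟨m, hm, hmi, -⟩ := exists_outer_image_M10
  have hmS : m ∉ image .S6 := fun hx => hmi (by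
    rw [← inf_image (k := .S6) (k' := .M10) (by simp) (by simp) (by simp)]; exact ⟨hx, hm⟩)
  have hmP : m ∉ image .PGL29 := fun hx => hmi (by
    rw [← inf_image (k := .PGL29) (k' := .M10) (by simp) (by simp) (by simp)]; exact ⟨hx, hm⟩)
  -- Both factors lie outside `S6` and outside `PGL(2,9)`, so the product lies in both; then `g`
  -- lies in `M10` with `m`.
  have hgm : g * m ∈ inn := by
    rw [← inf_image (k := .S6) (k' := .PGL29) (by simp) (by simp) (by simp)]
    constructor
    · exact (Subgroup.mul_mem_iff_of_index_two (index_image (by simp))).2 (iff_of_false hS hmS)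
    · exact (Subgroup.mul_mem_iff_of_index_two (index_image (by simp))).2 (iff_of_false hP hmP)
  exact h .M10 (by simp) ((Subgroup.mul_mem_cancel_right _ hm).1 (inn_le_image _ hgm))

theorem exists_eq_image_of_card {N : Subgroup (MulAut A6)} (hN : inn ≤ N)
    (hc : Nat.card N = 720) : ∃ k, N = image k := by
  obtain ⟨g, hg, hgi⟩ : ∃ g ∈ N, g ∉ inn := by
    by_contra! h
    have := le_antisymm hN h
    rw [← this, card_inn] at hc
    norm_num at hc
  obtain ⟨k, hk, hgk⟩ := exists_mem_image g
  refine ⟨k, ?_⟩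
  by_contra hne
  refine hgi ?_
  rw [← inf_eq_inn hc (card_image hk) hN (inn_le_image k) hne]
  exact ⟨hg, hgk⟩

theorem exists_equiv_of_isCandidate {k : Kind} {M N : Subgroup (MulAut A6)}
    (hM : IsCandidate k M) (hN : IsCandidate k N) : Nonempty (M ≃* N) := by
  cases k <;> obtain ⟨e⟩ := hM <;> obtain ⟨f⟩ := hN <;> exact ⟨e.trans f.symm⟩

theorem isCandidate_iff {k : Kind} {N : Subgroup (MulAut A6)} : IsCandidate k N ↔ N = image k := by
  refine ⟨fun hN => ?_, fun h => h ▸ isCandidate_image k⟩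
  obtain ⟨e⟩ := exists_equiv_of_isCandidate (isCandidate_image k) hN
  let f : A6 →* image k := MulAut.conj.codRestrict _ fun a => inn_le_image k ⟨a, rfl⟩
  have hf : Function.Injective f := fun a b h => conj_A6_injective (congrArg Subtype.val h)
  let j : A6 →* MulAut A6 := N.subtype.comp (e.toMonoidHom.comp f)
  have hj : Function.Injective j := N.subtype_injective.comp (e.injective.comp hf)
  -- The copy of `A6` inside `N` is inner and has full order, which puts `inn` inside `N`.
  have hr : j.range = inn := by
    refine Subgroup.eq_of_le_of_card_ge ?_ ?_
    · rintro _ ⟨a, rfl⟩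
      exact hom_A6_mem_inn j a
    · rw [card_inn, ← card_A6]
      exact (Nat.card_congr (MonoidHom.ofInjective hj).toEquiv).le
  have hle : inn ≤ N := by
    rw [← hr]
    rintro _ ⟨a, rfl⟩
    exact (e (f a)).2
  have hcard := Nat.card_congr e.toEquiv
  obtain ⟨k', rfl⟩ : ∃ k', N = image k' := by
    by_cases hk : k = .A6
    · subst hk
      refine ⟨.A6, ?_⟩
      rw [image_A6]
      refine (Subgroup.eq_of_le_of_card_ge hle ?_).symm
      rw [← hcard, image_A6]
    · exact exists_eq_image_of_card hle (by rw [← hcard, card_image hk])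
  rw [eq_of_image_equiv e]

/-! ### Extensions of the group of fourth roots of unity by `A6` -/

theorem orderOf_zeta4 : orderOf zeta4 = 4 := by
  have h := Complex.isPrimitiveRoot_exp 4 (by norm_num)
  have h2 := h.eq_orderOf
  rw [← Subgroup.orderOf_coe, ← orderOf_units]
  convert h2.symm using 2
  simp [zeta4]

theorem mem_zpowers_zeta4 (z : Mu4) : z ∈ Subgroup.zpowers zeta4 := by
  have hcard : Nat.card Mu4 = 4 := Complex.card_rootsOfUnity 4
  have : Subgroup.zpowers zeta4 = ⊤ := by
    apply Subgroup.eq_top_of_card_eq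
    rw [Nat.card_zpowers, orderOf_zeta4, hcard]
  rw [this]
  exact Subgroup.mem_top z

/-- The inclusion of `A6 × 1`. -/
def innPair : A6 →* MulAut A6 × Mu4 := (MonoidHom.inl (MulAut A6) Mu4).comp MulAut.conj

theorem innPair_apply (a : A6) : innPair a = (MulAut.conj a, 1) := rfl

theorem innPair_injective : Function.Injective innPair := fun _ _ h =>
  conj_A6_injective (congrArg Prod.fst h)

theorem range_innPair : innPair.range = inn.prod ⊥ := by
  ext ⟨x, z⟩
  rw [Subgroup.mem_prod, Subgroup.mem_bot]
  constructor
  · rintro ⟨a, ha⟩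
    rw [innPair_apply, Prod.mk.injEq] at ha
    exact ⟨⟨a, ha.1⟩, ha.2.symm⟩
  · rintro ⟨⟨a, ha⟩, hz⟩
    exact ⟨a, Prod.ext ha hz.symm⟩

theorem innPair_mem_model (g : MulAut A6) (a : A6) : innPair a ∈ model g :=
  (le_sup_left : inn.prod ⊥ ≤ model g) (range_innPair ▸ ⟨a, rfl⟩)

theorem lift_mem_model (g : MulAut A6) : lift g ∈ model g :=
  (le_sup_right : _ ≤ model g) (Subgroup.mem_zpowers _)

theorem model_le {g : MulAut A6} {H : Subgroup (MulAut A6 × Mu4)} (h1 : ∀ a, innPair a ∈ H)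
    (h2 : lift g ∈ H) : model g ≤ H := by
  refine sup_le ?_ (Subgroup.zpowers_le.2 h2)
  rw [← range_innPair]
  rintro _ ⟨a, rfl⟩
  exact h1 a

theorem orderOf_lift {g : MulAut A6} (hg : g ^ 4 = 1) : orderOf (lift g) = 4 := by
  rw [Prod.orderOf]
  change Nat.lcm (orderOf g) (orderOf zeta4) = 4
  rw [orderOf_zeta4]
  exact Nat.lcm_eq_right (orderOf_dvd_of_pow_eq_one hg)

theorem lift_zpow_eq_one {g : MulAut A6} (hg : g ^ 4 = 1) {n : ℤ} (hn : zeta4 ^ n = 1) :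
    lift g ^ n = 1 := by
  rw [← orderOf_dvd_iff_zpow_eq_one, orderOf_zeta4] at hn
  rwa [← orderOf_dvd_iff_zpow_eq_one, orderOf_lift hg]

theorem lift_mul_innPair (x : MulAut A6 × Mu4) (a : A6) :
    x * innPair a * x⁻¹ = innPair (x.1 a) := by
  ext1
  · ext1 b
    simp [innPair_apply, MulAut.conj_apply]
  · simp [innPair_apply]

/-- The homomorphism from the semidirect product to `Aut(A6) × Mu4`. -/
noncomputable def semidirectHom (g : MulAut A6) :
    A6 ⋊[action g] Subgroup.zpowers (lift g) →* MulAut A6 × Mu4 :=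
  SemidirectProduct.lift innPair (Subgroup.zpowers (lift g)).subtype fun z => by
    ext1 a
    exact (lift_mul_innPair z a).symm

theorem semidirectHom_apply (g : MulAut A6) (x : A6 ⋊[action g] Subgroup.zpowers (lift g)) :
    semidirectHom g x = innPair x.left * x.right := rfl

/-- `lift g` and `zeta4` both have order 4, so the cyclic subgroup meets `A6 × 1` trivially. -/
theorem semidirectHom_injective {g : MulAut A6} (hg : g ^ 4 = 1) :
    Function.Injective (semidirectHom g) := by
  rw [injective_iff_map_eq_one]
  rintro ⟨a, ⟨_, n, rfl⟩⟩ hx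
  rw [semidirectHom_apply] at hx
  have h2 : zeta4 ^ n = 1 := by
    simpa [innPair_apply, lift] using congrArg Prod.snd hx
  have h1 : lift g ^ n = 1 := lift_zpow_eq_one hg h2
  change innPair a * lift g ^ n = 1 at hx
  rw [h1, mul_one] at hx
  have ha : a = 1 := innPair_injective (hx.trans (map_one _).symm)
  refine SemidirectProduct.ext ha (Subtype.ext h1)

theorem range_semidirectHom (g : MulAut A6) : (semidirectHom g).range = model g := by
  apply le_antisymm
  · rintro _ ⟨x, rfl⟩
    exact mul_mem (innPair_mem_model g _) ((le_sup_right : _ ≤ model g) x.right.2)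
  · refine model_le (fun a => ⟨SemidirectProduct.inl a, ?_⟩)
      ⟨SemidirectProduct.inr ⟨lift g, Subgroup.mem_zpowers _⟩, ?_⟩
    · simp [semidirectHom_apply]
    · simp [semidirectHom_apply]

theorem exists_of_mem_model {g : MulAut A6} {x : MulAut A6 × Mu4} (hx : x ∈ model g) :
    ∃ (a : A6) (n : ℤ), x = innPair a * lift g ^ n := by
  rw [← range_semidirectHom] at hx
  obtain ⟨⟨a, ⟨_, n, rfl⟩⟩, rfl⟩ := hx
  exact ⟨a, n, rfl⟩

theorem exists_semidirect_equiv {g : MulAut A6} (hg : g ^ 4 = 1) :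
    ∃ e : A6 ⋊[action g] Subgroup.zpowers (lift g) ≃* model g,
      ∀ x, (e x : MulAut A6 × Mu4) = (MulAut.conj x.left, 1) * (x.right : MulAut A6 × Mu4) :=
  ⟨(MonoidHom.ofInjective (semidirectHom_injective hg)).trans
    (MulEquiv.subgroupCongr (range_semidirectHom g)), fun _ => rfl⟩

/-- The model group as an extension. -/
noncomputable def modelExtension (g : MulAut A6) (hg : g ^ 4 = 1) :
    GroupExtension A6 (model g) Mu4 where
  inl := innPair.codRestrict _ (innPair_mem_model g)
  rightHom := (MonoidHom.snd _ _).comp (model g).subtype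
  inl_injective _ _ h := innPair_injective (congrArg Subtype.val h)
  range_inl_eq_ker_rightHom := by
    ext ⟨x, hx⟩
    constructor
    · rintro ⟨a, ha⟩
      rw [← ha]
      rfl
    · intro hx2
      obtain ⟨a, n, rfl⟩ := exists_of_mem_model hx
      have h2 : zeta4 ^ n = 1 := by
        have : (innPair a * lift g ^ n).2 = 1 := hx2
        simpa [innPair_apply, lift] using this
      refine ⟨a, Subtype.ext ?_⟩
      change innPair a = innPair a * lift g ^ n
      rw [lift_zpow_eq_one hg h2, mul_one]
  rightHom_surjective z := by
    obtain ⟨n, rfl⟩ := mem_zpowers_zeta4 z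
    exact ⟨⟨lift g ^ n, zpow_mem (lift_mem_model g) n⟩, rfl⟩

theorem conjAct_modelExtension {g : MulAut A6} (hg : g ^ 4 = 1) (x : model g) :
    (modelExtension g hg).conjAct x = (x : MulAut A6 × Mu4).1 := by
  ext1 a
  apply (modelExtension g hg).inl_injective
  rw [GroupExtension.inl_conjAct_comm]
  exact Subtype.ext (lift_mul_innPair x a)

/-! ### Arbitrary extensions inside `Aut(A6) × Mu4` -/

section Extension

variable {G : Type*} [Group G] (S : GroupExtension A6 G Mu4)

theorem conjAct_inl (a : A6) : S.conjAct (S.inl a) = MulAut.conj a := by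
  ext1 b
  apply S.inl_injective
  rw [GroupExtension.inl_conjAct_comm, MulAut.conj_apply, map_mul, map_mul, map_inv]

theorem inn_le_range_conjAct : inn ≤ S.conjAct.range := by
  rintro _ ⟨a, rfl⟩
  exact ⟨S.inl a, conjAct_inl S a⟩

theorem exists_inl_of_rightHom_eq_one {x : G} (hx : S.rightHom x = 1) : ∃ a, S.inl a = x := by
  have : x ∈ S.rightHom.ker := hx
  rwa [← S.range_inl_eq_ker_rightHom] at this

/-- The embedding of an extension into `Aut(A6) × Mu4`. -/
noncomputable def toProd : G →* MulAut A6 × Mu4 := S.conjAct.prod S.rightHom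

theorem toProd_inl (a : A6) : toProd S (S.inl a) = innPair a :=
  Prod.ext (conjAct_inl S a) (S.rightHom_inl a)

theorem toProd_injective : Function.Injective (toProd S) := by
  rw [injective_iff_map_eq_one]
  intro x hx
  obtain ⟨a, rfl⟩ := exists_inl_of_rightHom_eq_one S (congrArg Prod.snd hx)
  rw [toProd_inl] at hx
  rw [innPair_injective (hx.trans (map_one _).symm), map_one]

theorem exists_inl_mul_zpow {x₀ : G} (hx₀ : S.rightHom x₀ = zeta4) (x : G) :
    ∃ (a : A6) (n : ℤ), x = S.inl a * x₀ ^ n := by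
  obtain ⟨n, hn⟩ := mem_zpowers_zeta4 (S.rightHom x)
  obtain ⟨a, ha⟩ := exists_inl_of_rightHom_eq_one S (x := x * (x₀ ^ n)⁻¹) (by
    rw [map_mul, map_inv, map_zpow, hx₀]
    exact mul_inv_eq_one.2 hn.symm)
  exact ⟨a, n, by rw [ha, inv_mul_cancel_right]⟩

theorem range_toProd {x₀ : G} (hx₀ : S.rightHom x₀ = zeta4) :
    (toProd S).range = model (S.conjAct x₀) := by
  have h0 : toProd S x₀ = lift (S.conjAct x₀) := Prod.ext rfl hx₀
  apply le_antisymm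
  · rintro _ ⟨x, rfl⟩
    obtain ⟨a, n, rfl⟩ := exists_inl_mul_zpow S hx₀ x
    rw [map_mul, map_zpow, toProd_inl, h0]
    exact mul_mem (innPair_mem_model _ a) (zpow_mem (lift_mem_model _) n)
  · exact model_le (fun a => ⟨S.inl a, toProd_inl S a⟩) ⟨x₀, h0⟩

theorem range_conjAct_le {x₀ : G} (hx₀ : S.rightHom x₀ = zeta4) {H : Subgroup (MulAut A6)}
    (hH : inn ≤ H) (h : S.conjAct x₀ ∈ H) : S.conjAct.range ≤ H := by
  rintro _ ⟨x, rfl⟩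
  obtain ⟨a, n, rfl⟩ := exists_inl_mul_zpow S hx₀ x
  rw [map_mul, map_zpow, conjAct_inl]
  exact mul_mem (hH ⟨a, rfl⟩) (zpow_mem h n)

/-- Modulo `inn` the image is generated by the class of one element, which lies in one of the three
subgroups of order 720. -/
theorem exists_range_conjAct_eq_image : ∃ k, S.conjAct.range = image k := by
  obtain ⟨x₀, hx₀⟩ := S.rightHom_surjective zeta4
  obtain ⟨k, hk, hxk⟩ := exists_mem_image (S.conjAct x₀)
  rcases eq_inn_or_eq_of_le (card_image hk) (inn_le_range_conjAct S)
    (range_conjAct_le S hx₀ (inn_le_image k) hxk) with h | h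
  · exact ⟨.A6, h.trans image_A6.symm⟩
  · exact ⟨k, h⟩

end Extension

/-! ### Classification by the image in `Aut(A6)` -/

theorem model_le_model {g h : MulAut A6} (hgh : h * g⁻¹ ∈ inn) : model h ≤ model g := by
  obtain ⟨a, ha⟩ := hgh
  refine model_le (innPair_mem_model g) ?_
  have : lift h = innPair a * lift g := by
    refine Prod.ext ?_ (one_mul _).symm
    change h = MulAut.conj a * g
    rw [ha, inv_mul_cancel_right]
  rw [this]
  exact mul_mem (innPair_mem_model g a) (lift_mem_model g)

theorem model_eq_model {g h : MulAut A6} (hgh : h * g⁻¹ ∈ inn) : model h = model g := by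
  refine le_antisymm (model_le_model hgh) (model_le_model ?_)
  simpa using inv_mem hgh

/-- `image k` has a single coset of outer elements. To see this, a second subgroup of index 2 is
intersected with it. -/
theorem mul_inv_mem_inn {k : Kind} (hk : k ≠ .A6) {x y : MulAut A6} (hx : x ∈ image k)
    (hy : y ∈ image k) (hxi : x ∉ inn) (hyi : y ∉ inn) : x * y⁻¹ ∈ inn := by
  obtain ⟨k', hk', hne⟩ : ∃ k', k' ≠ Kind.A6 ∧ k ≠ k' := by
    cases k
    exacts [absurd rfl hk, ⟨.M10, by simp, by simp⟩, ⟨.M10, by simp, by simp⟩,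
      ⟨.S6, by simp, by simp⟩]
  rw [← inf_image hk hk' hne] at hxi hyi ⊢
  refine ⟨(image k).mul_mem hx ((image k).inv_mem hy), ?_⟩
  refine (Subgroup.mul_mem_iff_of_index_two (index_image hk')).2 (iff_of_false ?_ ?_)
  · exact fun h => hxi ⟨hx, h⟩
  · exact fun h => hyi ⟨hy, (image k').inv_mem_iff.1 h⟩

theorem exists_isFirstComponent (k : Kind) : ∃ g, IsFirstComponent k (image k) g := by
  cases k
  · exact ⟨1, rfl⟩
  · exact ⟨_, rfl⟩
  · obtain ⟨h, hh, h10⟩ := exists_ten_image_PGL29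
    exact ⟨h ^ 5, h, hh, h10, rfl⟩
  · obtain ⟨g, hg, hgi, h4⟩ := exists_outer_image_M10
    exact ⟨g, hg, hgi, h4⟩

theorem IsFirstComponent.mem_and_pow {k : Kind} {g : MulAut A6}
    (hg : IsFirstComponent k (image k) g) :
    g ∈ image k ∧ g ^ 4 = 1 ∧ (g ∈ inn ↔ k = .A6) := by
  cases k
  · obtain rfl : g = 1 := hg
    exact ⟨one_mem _, one_pow _, by simp [one_mem]⟩
  · obtain rfl : g = symAut (swap (0 : Fin 6) 1) := hg
    refine ⟨image_S6 ▸ ⟨_, rfl⟩, ?_, ?_⟩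
    · have h4 : swap (0 : Fin 6) 1 ^ 4 = 1 := by
        rw [pow_mul _ 2 2, pow_two (swap _ _), swap_mul_self, one_pow]
      rw [← map_pow, h4, map_one]
    · refine iff_of_false ?_ (by simp)
      rintro ⟨a, ha⟩
      rw [← symAut_coe] at ha
      have h1 := symAut_injective ha
      have h2 := Perm.mem_alternatingGroup.1 a.2
      rw [h1, Perm.sign_swap (by decide)] at h2
      exact absurd h2 (by decide)
  · obtain ⟨h, hh, h10, rfl⟩ := hg
    have hp : h ^ 10 = 1 := h10 ▸ pow_orderOf_eq_one h
    refine ⟨pow_mem hh 5, ?_, ?_⟩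
    · rw [← pow_mul, show 5 * 4 = 10 * 2 from rfl, pow_mul, hp, one_pow]
    · refine iff_of_false (fun h5 => ?_) (by simp)
      -- If `h ^ 5` were inner, so would be `h ^ 5 * (h ^ 2) ^ 3 = h ^ 11 = h`, but `A6` has no
      -- element of order 10.
      have hi : h ∈ inn := by
        have h6 := pow_mem (sq_mem_inn h) 3
        rw [← pow_mul] at h6
        have := mul_mem (pow_mem h5 1) h6
        rw [pow_one, ← pow_add, show 5 + 2 * 3 = 10 + 1 from rfl, pow_add, hp, one_mul,
          pow_one] at this
        exact this
      obtain ⟨a, rfl⟩ := hi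
      have h10' : orderOf (MulAut.conj a) = 10 := h10
      rw [orderOf_injective _ conj_A6_injective] at h10'
      exact orderOf_A6_ne_ten a h10'
  · exact ⟨hg.1, hg.2.2 ▸ pow_orderOf_eq_one g, iff_of_false hg.2.1 (by simp)⟩

theorem eq_image_of_mem {k : Kind} {g : MulAut A6} (hg : IsFirstComponent k (image k) g)
    {H : Subgroup (MulAut A6)} (h1 : inn ≤ H) (h2 : H ≤ image k) (hgH : g ∈ H) : H = image k := by
  obtain ⟨-, -, hi⟩ := hg.mem_and_pow
  by_cases hk : k = .A6
  · subst hk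
    rw [image_A6] at h2 ⊢
    exact le_antisymm h2 h1
  · refine (eq_inn_or_eq_of_le (card_image hk) h1 h2).resolve_left fun h => hk (hi.1 ?_)
    rwa [h] at hgH

theorem model_le_prod {k : Kind} {g : MulAut A6} (hg : g ∈ image k) :
    model g ≤ (image k).prod ⊤ :=
  model_le (fun a => ⟨inn_le_image k ⟨a, rfl⟩, Subgroup.mem_top _⟩) ⟨hg, Subgroup.mem_top _⟩

theorem range_conjAct_modelExtension {k : Kind} {g : MulAut A6}
    (hg : IsFirstComponent k (image k) g) (h4 : g ^ 4 = 1) :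
    (modelExtension g h4).conjAct.range = image k := by
  refine eq_image_of_mem hg (inn_le_range_conjAct _) ?_
    ⟨⟨lift g, lift_mem_model g⟩, conjAct_modelExtension h4 _⟩
  rintro _ ⟨x, rfl⟩
  rw [conjAct_modelExtension]
  exact (model_le_prod hg.mem_and_pow.1 x.2).1

/-- A lift of `zeta4` acts by an outer automorphism unless `k` is `.A6`, so its action lies in the
same coset of `inn` as `g`, and the two model subgroups coincide. -/
theorem nonempty_equiv_model {G : Type*} [Group G] (S : GroupExtension A6 G Mu4) {k : Kind}
    (hS : S.conjAct.range = image k) {g : MulAut A6} (hg : IsFirstComponent k (image k) g) :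
    Nonempty (G ≃* model g) := by
  obtain ⟨hgk, -, hgi⟩ := hg.mem_and_pow
  obtain ⟨x₀, hx₀⟩ := S.rightHom_surjective zeta4
  have hxk : S.conjAct x₀ ∈ image k := hS ▸ ⟨x₀, rfl⟩
  have key : S.conjAct x₀ * g⁻¹ ∈ inn := by
    by_cases hk : k = .A6
    · subst hk
      rw [image_A6] at hxk hgk
      exact mul_mem hxk (inv_mem hgk)
    · refine mul_inv_mem_inn hk hxk hgk (fun hi => hk ?_) (fun hi => hk (hgi.1 hi))
      apply image_injective
      rw [image_A6, ← hS]
      exact le_antisymm (range_conjAct_le S hx₀ le_rfl hi) (inn_le_range_conjAct S)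
  exact ⟨(MonoidHom.ofInjective (toProd_injective S)).trans
    (MulEquiv.subgroupCongr ((range_toProd S hx₀).trans (model_eq_model key)))⟩

theorem range_conjAct_le_of_equiv {G G' : Type*} [Group G] [Group G']
    (S : GroupExtension A6 G Mu4) (S' : GroupExtension A6 G' Mu4) (φ : G ≃* G') :
    S'.conjAct.range ≤ S.conjAct.range := by
  have hφ : ∀ a, φ (S.inl a) ∈ S'.inl.range := by
    intro a
    rw [S'.range_inl_eq_ker_rightHom]
    exact hom_A6_eq_one (S'.rightHom.comp (φ.toMonoidHom.comp S.inl)) a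
  choose f hf using hφ
  have hinj : Function.Injective f := by
    intro a b h
    apply S.inl_injective
    apply φ.injective
    rw [← hf, ← hf, h]
  -- The restriction of `φ` to the kernels; injectivity suffices by finiteness. It conjugates one
  -- image to the other.
  let α : MulAut A6 := MulEquiv.mk (Equiv.ofBijective f (Finite.injective_iff_bijective.1 hinj))
    fun a b => S'.inl_injective (by
      change S'.inl (f (a * b)) = S'.inl (f a * f b)
      rw [hf, map_mul, map_mul, map_mul, hf, hf])
  have hα : ∀ a, S'.inl (α a) = φ (S.inl a) := hf
  rintro _ ⟨y, rfl⟩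
  obtain ⟨x, rfl⟩ := φ.surjective y
  have key : S'.conjAct (φ x) = α * S.conjAct x * α⁻¹ := by
    rw [eq_mul_inv_iff_mul_eq]
    ext1 a
    apply S'.inl_injective
    rw [MulAut.mul_apply, MulAut.mul_apply, GroupExtension.inl_conjAct_comm, hα, hα,
      GroupExtension.inl_conjAct_comm, map_mul, map_mul, map_inv]
  rw [key]
  exact conj_mem_of_inn_le (inn_le_range_conjAct S) ⟨x, rfl⟩ α

theorem nonempty_equiv_iff {G G' : Type*} [Group G] [Group G']
    (S : GroupExtension A6 G Mu4) (S' : GroupExtension A6 G' Mu4) :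
    Nonempty (G ≃* G') ↔ S.conjAct.range = S'.conjAct.range := by
  constructor
  · rintro ⟨φ⟩
    exact le_antisymm (range_conjAct_le_of_equiv S' S φ.symm) (range_conjAct_le_of_equiv S S' φ)
  · intro h
    obtain ⟨k, hk⟩ := exists_range_conjAct_eq_image S
    obtain ⟨g, hg⟩ := exists_isFirstComponent k
    obtain ⟨e⟩ := nonempty_equiv_model S hk hg
    obtain ⟨e'⟩ := nonempty_equiv_model S' (h.symm.trans hk) hg
    exact ⟨e.trans e'.symm⟩

theorem model_one : model 1 = inn.prod ⊤ := by
  apply le_antisymm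
  · exact model_le (fun a => ⟨⟨a, rfl⟩, Subgroup.mem_top _⟩) ⟨one_mem _, Subgroup.mem_top _⟩
  · rintro ⟨_, z⟩ ⟨⟨a, rfl⟩, -⟩
    obtain ⟨n, rfl⟩ := mem_zpowers_zeta4 z
    have : ((MulAut.conj a, zeta4 ^ n) : MulAut A6 × Mu4) = innPair a * lift 1 ^ n := by
      ext1
      · simp [innPair_apply, lift]
      · simp [innPair_apply, lift]
    exact this ▸ mul_mem (innPair_mem_model 1 a) (zpow_mem (lift_mem_model 1) n)

theorem nonempty_model_one_equiv : Nonempty (model 1 ≃* A6 × Mu4) :=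
  ⟨((MulEquiv.subgroupCongr model_one).trans (Subgroup.prodEquiv _ _)).trans
    (MulEquiv.prodCongr (MonoidHom.ofInjective conj_A6_injective).symm Subgroup.topEquiv)⟩

end A6Ext

theorem theorem2p3 :
    -- `Aut(A6)` has exactly one subgroup of each of the four kinds
    (∀ k : A6Ext.Kind, ∃! N : Subgroup (MulAut A6Ext.A6), A6Ext.IsCandidate k N) ∧
    -- the four model groups: they exist, are natural semidirect products inside `N × Mu4`,
    -- and are extensions of `Mu4` by `A6` with image `N` in `Aut(A6)`
    (∀ (k : A6Ext.Kind) (N : Subgroup (MulAut A6Ext.A6)), A6Ext.IsCandidate k N →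
      (∃ g, A6Ext.IsFirstComponent k N g) ∧
      ∀ g, A6Ext.IsFirstComponent k N g →
        A6Ext.model g ≤ N.prod ⊤ ∧
        orderOf (A6Ext.lift g) = 4 ∧
        (∃ e : A6Ext.A6 ⋊[A6Ext.action g] Subgroup.zpowers (A6Ext.lift g) ≃* A6Ext.model g,
          ∀ x, (e x : MulAut A6Ext.A6 × A6Ext.Mu4) =
            (MulAut.conj x.left, 1) * (x.right : MulAut A6Ext.A6 × A6Ext.Mu4)) ∧
        (∃ S : GroupExtension A6Ext.A6 (A6Ext.model g) A6Ext.Mu4,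
          (∀ a, (S.inl a : MulAut A6Ext.A6 × A6Ext.Mu4) = (MulAut.conj a, 1)) ∧
          (∀ x, S.rightHom x = (x : MulAut A6Ext.A6 × A6Ext.Mu4).2) ∧
          S.conjAct.range = N)) ∧
    -- for the first kind the model is the full direct product
    (A6Ext.model 1 = A6Ext.inn.prod ⊤ ∧
      Nonempty (A6Ext.model 1 ≃* A6Ext.A6 × A6Ext.Mu4)) ∧
    -- every extension of `Mu4` by `A6` has one of the four images `N`, and is isomorphic to
    -- the model group belonging to that image
    (∀ (G : Type*) [Group G] (S : GroupExtension A6Ext.A6 G A6Ext.Mu4),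
      (∃ k, A6Ext.IsCandidate k S.conjAct.range) ∧
      ∀ k g, A6Ext.IsCandidate k S.conjAct.range →
        A6Ext.IsFirstComponent k S.conjAct.range g → Nonempty (G ≃* A6Ext.model g)) ∧
    -- model groups of different kinds are not isomorphic
    (∀ (k k' : A6Ext.Kind) (N N' : Subgroup (MulAut A6Ext.A6)) (g g' : MulAut A6Ext.A6),
      A6Ext.IsCandidate k N → A6Ext.IsFirstComponent k N g →
      A6Ext.IsCandidate k' N' → A6Ext.IsFirstComponent k' N' g' →
      Nonempty (A6Ext.model g ≃* A6Ext.model g') → k = k') ∧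
    -- two extensions are isomorphic as groups exactly when their images agree
    (∀ (G G' : Type*) [Group G] [Group G'] (S : GroupExtension A6Ext.A6 G A6Ext.Mu4)
      (S' : GroupExtension A6Ext.A6 G' A6Ext.Mu4),
      Nonempty (G ≃* G') ↔ S.conjAct.range = S'.conjAct.range) := by
  refine ⟨fun k => ⟨A6Ext.image k, A6Ext.isCandidate_image k, fun N h => A6Ext.isCandidate_iff.1 h⟩,
    ?_, ⟨A6Ext.model_one, A6Ext.nonempty_model_one_equiv⟩, ?_, ?_,
    fun G G' _ _ S S' => A6Ext.nonempty_equiv_iff S S'⟩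
  · intro k N hN
    obtain rfl := A6Ext.isCandidate_iff.1 hN
    refine ⟨A6Ext.exists_isFirstComponent k, fun g hg => ?_⟩
    obtain ⟨hgk, h4, -⟩ := hg.mem_and_pow
    exact ⟨A6Ext.model_le_prod hgk, A6Ext.orderOf_lift h4, A6Ext.exists_semidirect_equiv h4,
      A6Ext.modelExtension g h4, fun _ => rfl, fun _ => rfl,
      A6Ext.range_conjAct_modelExtension hg h4⟩
  · intro G _ S
    obtain ⟨k, hk⟩ := A6Ext.exists_range_conjAct_eq_image S
    refine ⟨⟨k, A6Ext.isCandidate_iff.2 hk⟩, fun k g hc hg => ?_⟩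
    have h := A6Ext.isCandidate_iff.1 hc
    rw [h] at hg
    exact A6Ext.nonempty_equiv_model S h hg
  · intro k k' N N' g g' hN hg hN' hg' e
    obtain rfl := A6Ext.isCandidate_iff.1 hN
    obtain rfl := A6Ext.isCandidate_iff.1 hN'
    have h := (A6Ext.nonempty_equiv_iff (A6Ext.modelExtension g hg.mem_and_pow.2.1)
      (A6Ext.modelExtension g' hg'.mem_and_pow.2.1)).1 e
    rw [A6Ext.range_conjAct_modelExtension hg, A6Ext.range_conjAct_modelExtension hg'] at h
    exact A6Ext.image_injective h
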